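/- Let $m,n\in\mathbb N$ and let $f\colon\mathbb R^{m\times n}\to\mathbb R$ be a Borel measurable function. Write $\mathbb T^n=\mathbb R^n/\mathbb Z^n$ with Lebesgue measure $|\cdot|$ (so $|\mathbb T^n|=1$). We say that $f$ is *quasiconvex* if for all $A\in\mathbb R^{m\times n}$ and all $\varphi\in C^\infty(\mathbb T^n,\mathbb R^m)$ the function $x\mapsto f(A+\mathrm D\varphi(x))$ is integrable on $\mathbb T^n$ and $$f(A)\le\int_{\mathbb T^n} f(A+\mathrm D\varphi(x))\,\mathrm dx .$$ Let $h\colon\mathbb R\to\{-1,1\}$ be the 1-periodic function with $h=1$ on $[0,\tfrac12)$ and $h=-1$ on $[\tfrac12,1)$, that is, the (right) derivative of the 1-periodic sawtooth function $s$ given by $s(t)=t$ on $[0,\tfrac12]$ and $s(t)=1-t$ on $[\tfrac12,1]$. For $N\in\mathbb N$ and $(a_i,n_i,c_i)\in\mathbb R^m\times\mathbb Z^n\times\mathbb R$, $i=1,\dots,N$, put, for $\varepsilon\in\{-1,1\}^N$, $$\nu_\varepsilon=\bigl|\{x\in\mathbb T^n: h(x\cdot n_i+c_i)=\varepsilon_i,\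 i=1,\dots,N\}\bigr|,\qquad X_\varepsilon=\sum_{i=1}^N\varepsilon_i\,a_i\otimes n_i ,$$ so that $\sum_\varepsilon\nu_\varepsilon\delta_{X_\varepsilon}$ is the distribution of the gradient of $\sum_{i=1}^N a_i\,s(x\cdot n_i+c_i)$ on $\mathbb T^n$. We say that $f$ is *$N$-wave quasiconvex at zero* if $$f(0)\le\sum_{\varepsilon\in\{-1,1\}^N}\nu_\varepsilon f(X_\varepsilon)\qquad\text{for all }(a_i,n_i,c_i)\in\mathbb R^m\times\mathbb Z^n\times\mathbb R,\ i=1,\dots,N,$$ and *$N$-wave quasiconvex* if $f(\cdot-A)$ is $N$-wave quasiconvex at zero for every $A\in\mathbb R^{m\times n}$. Then $f$ is quasiconvex if and only if $f$ is $N$-wave quasiconvex for every $N\in\mathbb N$. -/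

import Mathlib

open scoped ContDiff MeasureTheory

namespace PlaneWave

noncomputable section

/-- The half-open unit cube, a fundamental domain of the torus `ℝⁿ / ℤⁿ`. -/
def unitCube (n : ℕ) : Set (Fin n → ℝ) :=
  Set.univ.pi fun _ => Set.Ico (0 : ℝ) 1

/-- `ℤⁿ`-periodic maps on `ℝⁿ`, i.e. maps on the torus. -/
def IsPeriodic {m n : ℕ} (φ : (Fin n → ℝ) → (Fin m → ℝ)) : Prop :=
  ∀ (x : Fin n → ℝ) (k : Fin n → ℤ), φ (x + fun j => (k j : ℝ)) = φ x

/-- The Jacobian matrix `Dφ(x)`, with entries `∂φᵢ/∂xⱼ`. -/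
def jacobian {m n : ℕ} (φ : (Fin n → ℝ) → (Fin m → ℝ)) (x : Fin n → ℝ) :
    Matrix (Fin m) (Fin n) ℝ :=
  Matrix.of fun i j => fderiv ℝ φ x (Pi.single j 1) i

/-- (Morrey) quasiconvexity, tested with smooth periodic maps. The integral is required to
exist; this is automatic when `f` is Borel and locally bounded. -/
def Quasiconvex {m n : ℕ} (f : Matrix (Fin m) (Fin n) ℝ → ℝ) : Prop :=
  ∀ (A : Matrix (Fin m) (Fin n) ℝ) (φ : (Fin n → ℝ) → (Fin m → ℝ)),
    ContDiff ℝ ∞ φ → IsPeriodic φ →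
      MeasureTheory.IntegrableOn (fun x => f (A + jacobian φ x)) (unitCube n) ∧
        f A ≤ ∫ x in unitCube n, f (A + jacobian φ x)

/-- The 1-periodic sawtooth: `s t = t` on `[0, 1/2]` and `s t = 1 - t` on `[1/2, 1]`. -/
def sawtooth (t : ℝ) : ℝ :=
  if Int.fract t ≤ 1 / 2 then Int.fract t else 1 - Int.fract t

/-- The 1-periodic Haar wavelet: `1` on `[0, 1/2)` and `-1` on `[1/2, 1)`. -/
def haar (t : ℝ) : ℝ :=
  if Int.fract t < 1 / 2 then 1 else -1

/-- The Haar wavelet is the (right) derivative of the sawtooth. -/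
theorem hasDerivWithinAt_sawtooth (t : ℝ) :
    HasDerivWithinAt sawtooth (haar t) (Set.Ici t) t := by
  have h0 := Int.fract_nonneg t
  have h1 := Int.fract_lt_one t
  have hs := Int.self_sub_floor t
  have key : ∀ y ∈ Set.Ico t (⌊t⌋ + 1 : ℝ), Int.fract y = y - ⌊t⌋ := by
    intro y hy
    rw [← Int.self_sub_floor y, Int.floor_eq_iff.2 ⟨(Int.floor_le t).trans hy.1, hy.2⟩]
  unfold haar
  split_ifs with h
  · have hd : HasDerivWithinAt (fun y : ℝ => y - ⌊t⌋) 1 (Set.Ici t) t :=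
      ((hasDerivAt_id t).sub_const _).hasDerivWithinAt
    refine hd.congr_of_eventuallyEq ?_ ?_
    · filter_upwards [Ico_mem_nhdsGE (show t < ⌊t⌋ + 1 / 2 by linarith)] with y hy
      have e := key y ⟨hy.1, by linarith [hy.2]⟩
      rw [sawtooth, if_pos (by rw [e]; linarith [hy.2]), e]
    · rw [sawtooth, if_pos h.le, hs]
  · have hd : HasDerivWithinAt (fun y : ℝ => 1 - (y - ⌊t⌋)) (-1) (Set.Ici t) t :=
      (((hasDerivAt_id t).sub_const _).const_sub 1).hasDerivWithinAt
    have aux : ∀ y ∈ Set.Ico t (⌊t⌋ + 1 : ℝ), sawtooth y = 1 - (y - ⌊t⌋) := by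
      intro y hy
      have e := key y hy
      unfold sawtooth
      split_ifs with h' <;> rw [e] at *
      linarith [hy.1]
    refine hd.congr_of_eventuallyEq ?_ ?_
    · filter_upwards [Ico_mem_nhdsGE (show t < ⌊t⌋ + 1 by linarith)] with y hy using aux y hy
    · exact aux t ⟨le_rfl, by linarith⟩

/-- The weight `ν_ε`: the measure of the set of points `x` of the torus with
`h(x · nᵢ + cᵢ) = εᵢ` for all `i`. Signs `±1` are the units of `ℤ`. -/
def weight {n N : ℕ} (k : Fin N → Fin n → ℤ) (c : Fin N → ℝ) (ε : Fin N → ℤˣ) : ℝ :=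
  (MeasureTheory.volume
    {x ∈ unitCube n | ∀ i, haar ((∑ j, x j * (k i j : ℝ)) + c i) = ((ε i : ℤ) : ℝ)}).toReal

/-- The matrix `X_ε = ∑ᵢ εᵢ aᵢ ⊗ nᵢ`. -/
def node {m n N : ℕ} (a : Fin N → Fin m → ℝ) (k : Fin N → Fin n → ℤ) (ε : Fin N → ℤˣ) :
    Matrix (Fin m) (Fin n) ℝ :=
  ∑ i, ((ε i : ℤ) : ℝ) • Matrix.vecMulVec (a i) (fun j => (k i j : ℝ))

/-- `N`-wave quasiconvexity at zero. -/
def WaveQuasiconvexAtZero {m n : ℕ} (N : ℕ) (f : Matrix (Fin m) (Fin n) ℝ → ℝ) : Prop :=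
  ∀ (a : Fin N → Fin m → ℝ) (k : Fin N → Fin n → ℤ) (c : Fin N → ℝ),
    f 0 ≤ ∑ ε : Fin N → ℤˣ, weight k c ε * f (node a k ε)

/-- `N`-wave quasiconvexity. -/
def WaveQuasiconvex {m n : ℕ} (N : ℕ) (f : Matrix (Fin m) (Fin n) ℝ → ℝ) : Prop :=
  ∀ A : Matrix (Fin m) (Fin n) ℝ, WaveQuasiconvexAtZero N (fun B => f (B - A))

end

end PlaneWave

/-! Both directions pass to the limit in `∫ f (A + Y)`, where the fields `Y` converge pointwise and
stay uniformly bounded. Dominated convergence (`tendsto_integral_unitCube_comp`) allows this once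
`f` is continuous, whereas `f` is only assumed Borel. Continuity is therefore proved first. Under
either hypothesis `f` is midpoint convex along the directions `a ⊗ eⱼ`, hence separately midpoint
convex in the matrix entries, and a measurable function with this property is continuous
(`SeparatelyMidpointConvex.continuous`).

For wave quasiconvexity, midpoint convexity is the case of one wave with frequency `eⱼ`. For
quasiconvexity, a smoothed sawtooth is the test map. The contribution of its ramps is exactly `δ`
times a constant independent of `δ`, so it vanishes as `δ → 0` without any local bound on `f`.

Quasiconvex implies wave quasiconvex: a sum of sawtooth waves is replaced by a sum of smooth
periodic ones, whose gradients converge pointwise to the sawtooth gradient.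

Wave quasiconvex implies quasiconvex: the gradient of a smooth periodic map is a uniform limit of
gradients of sums of sawtooth waves (`isWaveLimit_jacobian`). Convolution with a trigonometric
polynomial only multiplies each Fourier coefficient of `Dφ` by a scalar. By integration by parts the
coefficient at frequency `k` has the form `b ⊗ k`, so the approximant is a sum of cosine plane waves
with rank-one amplitudes. The cosine is in turn a uniform limit of combinations of translates of the
Haar wavelet (`abs_cos_sub_cosStep_le`), because both are antiperiodic with antiperiod `1/2`. -/

namespace PlaneWave
-- Measurable separately midpoint convex functions are continuous.
section MidpointConvex

open MeasureTheory Filter Topology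

variable {ι : Type*} [DecidableEq ι]

/-- Midpoint convexity along every coordinate direction. -/
def SeparatelyMidpointConvex (g : (ι → ℝ) → ℝ) : Prop :=
  ∀ x i t, g x ≤ (g (x + Pi.single i t) + g (x - Pi.single i t)) / 2

/-- Splitting one coordinate at a time shows that the value at the centre of a box is at most the
largest value at its corners. -/
theorem SeparatelyMidpointConvex.le_of_corners [Fintype ι] {g : (ι → ℝ) → ℝ}
    (hg : SeparatelyMidpointConvex g) (u : ι → ℝ) (M : ℝ) (y : ι → ℝ)
    (h : ∀ z : ι → ℝ, (∀ i, z i = y i + u i ∨ z i = y i - u i) → g z ≤ M) : g y ≤ M := by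
  have key : ∀ (S : Finset ι) (y : ι → ℝ),
      (∀ z : ι → ℝ, (∀ i ∈ S, z i = y i + u i ∨ z i = y i - u i) → (∀ i ∉ S, z i = y i) →
        g z ≤ M) → g y ≤ M := by
    intro S
    induction S using Finset.induction_on with
    | empty => exact fun y h => h y (by simp) (by simp)
    | insert a S ha ih =>
      intro y h
      have aux : ∀ t, (t = u a ∨ t = -u a) → g (y + Pi.single a t) ≤ M := by
        intro t ht
        refine ih _ fun z hz hz' => h z ?_ ?_
        · intro i hi
          rcases Finset.mem_insert.1 hi with rfl | hi
          · rw [hz' i ha]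
            rcases ht with rfl | rfl
            · left; simp
            · right; simp [sub_eq_add_neg]
          · have : i ≠ a := fun e => ha (e ▸ hi)
            simpa [this] using hz i hi
        · intro i hi
          rw [Finset.mem_insert, not_or] at hi
          simpa [hi.1] using hz' i hi.2
      have h1 := aux _ (Or.inl rfl)
      have h2 := aux _ (Or.inr rfl)
      have h3 := hg y a (u a)
      rw [Pi.single_neg, ← sub_eq_add_neg] at h2
      linarith
  exact key Finset.univ y fun z hz _ => h z fun i => hz i (Finset.mem_univ i)

/-- A Steinhaus-type argument: the superlevel sets in a ball shrink to measure zero, so for a high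
level some box centred at `x` has all its corners outside the superlevel set. -/
theorem SeparatelyMidpointConvex.exists_upper_bound [Fintype ι] {g : (ι → ℝ) → ℝ}
    (hg : SeparatelyMidpointConvex g) (hm : Measurable g) (x₀ : ι → ℝ) :
    ∃ M, ∀ x ∈ Metric.closedBall x₀ 1, g x ≤ M := by
  have hE : ∀ k : ℕ, MeasurableSet {x | (k : ℝ) < g x} := fun k => hm measurableSet_Ioi
  have hlim : Tendsto (fun k : ℕ => volume (Metric.closedBall x₀ 2 ∩ {x | (k : ℝ) < g x}))
      atTop (𝓝 0) := by
    have h0 : (⋂ k : ℕ, Metric.closedBall x₀ 2 ∩ {x | (k : ℝ) < g x}) = ∅ := by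
      refine Set.eq_empty_of_forall_notMem fun x hx => ?_
      obtain ⟨k, hk⟩ := exists_nat_gt (g x)
      have := (Set.mem_iInter.1 hx k).2
      exact lt_asymm hk this
    rw [← measure_empty (μ := (volume : Measure (ι → ℝ))), ← h0]
    refine tendsto_measure_iInter_atTop
      (fun k => (Metric.isClosed_closedBall.measurableSet.inter (hE k)).nullMeasurableSet) ?_
      ⟨0, ((measure_mono Set.inter_subset_left).trans_lt measure_closedBall_lt_top).ne⟩
    intro k l hkl
    refine Set.inter_subset_inter_right _ fun x hx => ?_
    have : (k : ℝ) ≤ l := by exact_mod_cast hkl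
    exact lt_of_le_of_lt this hx
  have hpos : 0 < volume (Metric.closedBall (0 : ι → ℝ) 1) :=
    Metric.measure_closedBall_pos _ _ one_pos
  have hlim' := ENNReal.Tendsto.const_mul (a := (Fintype.card (ι → Bool) : ENNReal)) hlim
    (Or.inr (ENNReal.natCast_ne_top _))
  rw [mul_zero] at hlim'
  -- The level is fixed before `x`: the bad set has the same measure under each of the `2^|ι|`
  -- corner maps `u ↦ x ± u`, so the union bound is uniform in `x`.
  obtain ⟨k, hk⟩ := ((tendsto_order.1 hlim').2 _ hpos).exists
  refine ⟨k, fun x hx => ?_⟩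
  let T : (ι → Bool) → (ι → ℝ) → (ι → ℝ) := fun σ u i => bif σ i then x i + u i else x i - u i
  have hT : ∀ σ, MeasurePreserving (T σ) volume volume := by
    intro σ
    refine volume_preserving_pi (f := fun i t => bif σ i then x i + t else x i - t) fun i => ?_
    cases σ i
    · exact Measure.measurePreserving_sub_left volume (x i)
    · exact measurePreserving_add_left volume (x i)
  have hB : volume (⋃ σ, T σ ⁻¹' (Metric.closedBall x₀ 2 ∩ {x | (k : ℝ) < g x})) <
      volume (Metric.closedBall (0 : ι → ℝ) 1) := by
    refine lt_of_le_of_lt (measure_iUnion_fintype_le _ _) ?_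
    have : ∀ σ, volume (T σ ⁻¹' (Metric.closedBall x₀ 2 ∩ {x | (k : ℝ) < g x})) =
        volume (Metric.closedBall x₀ 2 ∩ {x | (k : ℝ) < g x}) := fun σ =>
      (hT σ).measure_preimage
        (Metric.isClosed_closedBall.measurableSet.inter (hE k)).nullMeasurableSet
    simp_rw [this]
    simpa only [Finset.sum_const, Finset.card_univ, nsmul_eq_mul] using hk
  have : ∃ u ∈ Metric.closedBall (0 : ι → ℝ) 1,
      u ∉ ⋃ σ, T σ ⁻¹' (Metric.closedBall x₀ 2 ∩ {x | (k : ℝ) < g x}) := by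
    by_contra! hcon
    exact absurd (measure_mono hcon) (not_le.2 hB)
  obtain ⟨u, hu, hu'⟩ := this
  refine hg.le_of_corners u k x fun z hz => ?_
  by_contra! hzk
  refine hu' (Set.mem_iUnion.2 ⟨fun i => decide (z i = x i + u i), ?_⟩)
  have hTz : T (fun i => decide (z i = x i + u i)) u = z := by
    funext i
    by_cases h : z i = x i + u i
    · simp [T, h]
    · simp only [T, decide_eq_false h, cond_false]
      exact ((hz i).resolve_left h).symm
  rw [Set.mem_preimage, hTz]
  refine ⟨?_, hzk⟩
  rw [Metric.mem_closedBall, dist_pi_le_iff (by norm_num)]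
  intro i
  have h1 := (dist_pi_le_iff zero_le_one).1 (Metric.mem_closedBall.1 hx) i
  have h2 := (dist_pi_le_iff zero_le_one).1 (Metric.mem_closedBall.1 hu) i
  rw [Real.dist_eq, abs_le] at *
  simp only [Pi.zero_apply, sub_zero] at h2
  rcases hz i with h | h <;> constructor <;> linarith

/-- The lower bound comes from reflection: `x` and its mirror image in a coordinate have a midpoint
one coordinate closer to `x₀`, and the mirror image has value at most `M`. Each coordinate at most
doubles the deficit `M - g`. -/
theorem SeparatelyMidpointConvex.exists_abs_bound [Fintype ι] {g : (ι → ℝ) → ℝ}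
    (hg : SeparatelyMidpointConvex g) (hm : Measurable g) (x₀ : ι → ℝ) :
    ∃ M, ∀ x ∈ Metric.closedBall x₀ 1, |g x| ≤ M := by
  obtain ⟨M, hM⟩ := hg.exists_upper_bound hm x₀
  have key : ∀ (S : Finset ι), ∀ x ∈ Metric.closedBall x₀ 1, (∀ i ∉ S, x i = x₀ i) →
      M - g x ≤ 2 ^ S.card * (M - g x₀) := by
    intro S
    induction S using Finset.induction_on with
    | empty =>
      intro x _ hx
      have : x = x₀ := funext fun i => hx i (by simp)
      simp [this]
    | insert a S ha ih =>
      intro x hx hxS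
      have hx1 := (dist_pi_le_iff zero_le_one).1 (Metric.mem_closedBall.1 hx)
      have hy : Function.update x a (x₀ a) ∈ Metric.closedBall x₀ 1 := by
        rw [Metric.mem_closedBall, dist_pi_le_iff zero_le_one]
        intro i
        by_cases h : i = a
        · subst h; simp
        · simpa [h] using hx1 i
      have hz : Function.update x a (2 * x₀ a - x a) ∈ Metric.closedBall x₀ 1 := by
        rw [Metric.mem_closedBall, dist_pi_le_iff zero_le_one]
        intro i
        by_cases h : i = a
        · subst h
          have := hx1 i
          rw [Real.dist_eq, abs_le] at *
          simp only [Function.update_self]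
          constructor <;> linarith
        · simpa [h] using hx1 i
      have h1 := ih _ hy fun i hi => by
        by_cases h : i = a
        · subst h; simp
        · rw [Function.update_of_ne h]; exact hxS i (by simp [h, hi])
      have h2 := hg (Function.update x a (x₀ a)) a (x a - x₀ a)
      have e1 : Function.update x a (x₀ a) + Pi.single a (x a - x₀ a) = x := by
        funext i
        by_cases h : i = a
        · subst h; simp
        · simp [h]
      have e2 : Function.update x a (x₀ a) - Pi.single a (x a - x₀ a) =
          Function.update x a (2 * x₀ a - x a) := by
        funext i
        by_cases h : i = a
        · subst h; simp; ring
        · simp [h]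
      rw [e1, e2] at h2
      have h3 := hM _ hz
      rw [Finset.card_insert_of_notMem ha, pow_succ]
      linarith
  refine ⟨max M (2 ^ (Finset.univ : Finset ι).card * (M - g x₀) - M), fun x hx => abs_le.2 ⟨?_, ?_⟩⟩
  · have := key Finset.univ x hx (by simp)
    have := le_max_right M (2 ^ (Finset.univ : Finset ι).card * (M - g x₀) - M)
    linarith
  · exact (hM x hx).trans (le_max_left _ _)

theorem SeparatelyMidpointConvex.continuous [Fintype ι] {g : (ι → ℝ) → ℝ}
    (hg : SeparatelyMidpointConvex g) (hm : Measurable g) : Continuous g := by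
  rw [continuous_iff_continuousAt]
  intro x₀
  obtain ⟨M, hM⟩ := hg.exists_abs_bound hm x₀
  -- An increment over `s` is at most half the increment over `2 * s`. After `k` doublings the point
  -- is still in the unit ball, where increments are at most `2 * M`.
  have upper : ∀ (k : ℕ) (y : ι → ℝ) (i : ι) (s : ℝ), y ∈ Metric.closedBall x₀ (1 / 2) →
      2 ^ k * |s| ≤ 1 / 2 → g (y + Pi.single i s) - g y ≤ (1 / 2) ^ k * (2 * M) := by
    intro k y i
    induction k with
    | zero =>
      intro s hy hs
      have h1 : y + Pi.single i s ∈ Metric.closedBall x₀ 1 := by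
        rw [Metric.mem_closedBall, dist_pi_le_iff zero_le_one]
        intro j
        have h2 := (dist_pi_le_iff (by norm_num)).1 (Metric.mem_closedBall.1 hy) j
        by_cases h : j = i
        · subst h
          rw [pow_zero, one_mul] at hs
          rw [Real.dist_eq, abs_le] at *
          simp only [Pi.add_apply, Pi.single_eq_same]
          constructor <;> linarith
        · have : dist (y j) (x₀ j) ≤ 1 := h2.trans (by norm_num)
          simpa [h] using this
      have h2 := (abs_le.1 (hM _ h1)).2
      have h3 := (abs_le.1 (hM _ (Metric.closedBall_subset_closedBall (by norm_num) hy))).1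
      simp only [pow_zero, one_mul]
      linarith
    | succ k ih =>
      intro s hy hs
      have h1 := ih (2 * s) hy (by rw [abs_mul, abs_two, ← mul_assoc, ← pow_succ]; exact hs)
      have h2 := hg (y + Pi.single i s) i s
      have e : y + Pi.single i s + Pi.single i s = y + Pi.single i (2 * s) := by
        rw [add_assoc, ← Pi.single_add, two_mul]
      rw [e, add_sub_cancel_right] at h2
      rw [pow_succ]
      linarith
  have both : ∀ (k : ℕ) (y : ι → ℝ) (i : ι) (s : ℝ), y ∈ Metric.closedBall x₀ (1 / 2) →
      2 ^ k * |s| ≤ 1 / 2 → |g (y + Pi.single i s) - g y| ≤ (1 / 2) ^ k * (2 * M) := by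
    intro k y i s hy hs
    refine abs_le.2 ⟨?_, upper k y i s hy hs⟩
    have h1 := upper k y i (-s) hy (by rwa [abs_neg])
    have h2 := hg y i s
    rw [Pi.single_neg, ← sub_eq_add_neg] at h1
    linarith
  have tele : ∀ (k : ℕ) (S : Finset ι), ∀ x ∈ Metric.closedBall x₀ ((1 / 2) ^ (k + 1)),
      (∀ i ∉ S, x i = x₀ i) → |g x - g x₀| ≤ S.card * ((1 / 2) ^ k * (2 * M)) := by
    intro k S
    have hr : (0 : ℝ) ≤ (1 / 2) ^ (k + 1) := by positivity
    have hr2 : ((1 : ℝ) / 2) ^ (k + 1) ≤ 1 / 2 := by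
      rw [pow_succ]
      have : ((1 : ℝ) / 2) ^ k ≤ 1 := pow_le_one₀ (by norm_num) (by norm_num)
      linarith
    induction S using Finset.induction_on with
    | empty =>
      intro x _ hx
      have : x = x₀ := funext fun i => hx i (by simp)
      simp [this]
    | insert a S ha ih =>
      intro x hx hxS
      have hx1 := (dist_pi_le_iff hr).1 (Metric.mem_closedBall.1 hx)
      have hy : Function.update x a (x₀ a) ∈ Metric.closedBall x₀ ((1 / 2) ^ (k + 1)) := by
        rw [Metric.mem_closedBall, dist_pi_le_iff hr]
        intro i
        by_cases h : i = a
        · subst h; simp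
        · simpa [h] using hx1 i
      have h1 := ih _ hy fun i hi => by
        by_cases h : i = a
        · subst h; simp
        · rw [Function.update_of_ne h]; exact hxS i (by simp [h, hi])
      have h2 := both k (Function.update x a (x₀ a)) a (x a - x₀ a)
        (Metric.closedBall_subset_closedBall hr2 hy) (by
          have := hx1 a
          rw [Real.dist_eq] at this
          calc (2 : ℝ) ^ k * |x a - x₀ a| ≤ 2 ^ k * (1 / 2) ^ (k + 1) := by gcongr
            _ = 1 / 2 := by rw [pow_succ, ← mul_assoc, ← mul_pow]; norm_num)
      have e1 : Function.update x a (x₀ a) + Pi.single a (x a - x₀ a) = x := by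
        funext i
        by_cases h : i = a
        · subst h; simp
        · simp [h]
      rw [e1] at h2
      rw [Finset.card_insert_of_notMem ha]
      push_cast
      have h3 := abs_sub_le (g x) (g (Function.update x a (x₀ a))) (g x₀)
      linarith
  rw [Metric.continuousAt_iff']
  intro ε hε
  have hlim : Tendsto (fun k : ℕ => ((Finset.univ : Finset ι).card : ℝ) * ((1 / 2) ^ k * (2 * M)))
      atTop (𝓝 0) := by
    have := ((tendsto_pow_atTop_nhds_zero_of_lt_one (r := (1 / 2 : ℝ)) (by norm_num)
      (by norm_num)).mul_const (2 * M)).const_mul ((Finset.univ : Finset ι).card : ℝ)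
    simpa using this
  obtain ⟨k, hk⟩ := ((tendsto_order.1 hlim).2 ε hε).exists
  filter_upwards [Metric.closedBall_mem_nhds x₀
    (show (0 : ℝ) < (1 / 2) ^ (k + 1) by positivity)] with x hx
  rw [Real.dist_eq]
  exact (tele k Finset.univ x hx (by simp)).trans_lt hk

end MidpointConvex

/-! ### The unit cube as a product probability space. -/

section UnitCube

open MeasureTheory Filter Topology

theorem restrict_unitCube (n : ℕ) :
    volume.restrict (unitCube n) =
      Measure.pi fun _ : Fin n => (volume : Measure ℝ).restrict (Set.Ico 0 1) :=
  Measure.restrict_pi_pi (fun _ : Fin n => (volume : Measure ℝ)) fun _ => Set.Ico (0 : ℝ) 1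

instance isProbabilityMeasure_restrict_Ico :
    IsProbabilityMeasure ((volume : Measure ℝ).restrict (Set.Ico 0 1)) :=
  ⟨by simp⟩

instance isProbabilityMeasure_restrict_unitCube (n : ℕ) :
    IsProbabilityMeasure (volume.restrict (unitCube n)) := by
  rw [restrict_unitCube]; infer_instance

theorem measurePreserving_eval_unitCube {n : ℕ} (j : Fin n) :
    MeasurePreserving (fun x : Fin n → ℝ => x j) (volume.restrict (unitCube n))
      (volume.restrict (Set.Ico 0 1)) := by
  rw [restrict_unitCube]
  exact measurePreserving_eval (fun _ : Fin n => (volume : Measure ℝ).restrict (Set.Ico 0 1)) j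

end UnitCube

/-! ### Sawtooth waves: finite sums over sign patterns as integrals. -/

section Waves

open MeasureTheory Filter Topology

theorem measurable_haar : Measurable haar :=
  Measurable.ite (measurableSet_lt measurable_fract measurable_const) measurable_const
    measurable_const

/-- The sign of the Haar wavelet as a unit of `ℤ`. -/
noncomputable def haarSign (t : ℝ) : ℤˣ := if Int.fract t < 1 / 2 then 1 else -1

theorem coe_haarSign (t : ℝ) : ((haarSign t : ℤ) : ℝ) = haar t := by
  unfold haarSign haar; split_ifs <;> simp

theorem haar_eq_coe_iff (t : ℝ) (e : ℤˣ) : haar t = ((e : ℤ) : ℝ) ↔ haarSign t = e := by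
  rw [← coe_haarSign, Int.cast_inj, Units.val_inj]

variable {m n N : ℕ}

/-- The gradient of a sum of `N` sawtooth plane waves. -/
noncomputable def waveGradient (a : Fin N → Fin m → ℝ) (k : Fin N → Fin n → ℤ) (c : Fin N → ℝ)
    (x : Fin n → ℝ) : Matrix (Fin m) (Fin n) ℝ :=
  ∑ i, haar ((∑ j, x j * (k i j : ℝ)) + c i) • Matrix.vecMulVec (a i) (fun j => (k i j : ℝ))

/-- The pattern of signs of the Haar wavelets at a point. -/
noncomputable def signPattern (k : Fin N → Fin n → ℤ) (c : Fin N → ℝ) (x : Fin n → ℝ) :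
    Fin N → ℤˣ :=
  fun i => haarSign ((∑ j, x j * (k i j : ℝ)) + c i)

theorem node_signPattern (a : Fin N → Fin m → ℝ) (k : Fin N → Fin n → ℤ) (c : Fin N → ℝ)
    (x : Fin n → ℝ) : node a k (signPattern k c x) = waveGradient a k c x := by
  simp only [node, signPattern, coe_haarSign, waveGradient]

theorem measurableSet_signPattern_eq (k : Fin N → Fin n → ℤ) (c : Fin N → ℝ) (ε : Fin N → ℤˣ) :
    MeasurableSet {x | signPattern k c x = ε} := by
  have : {x | signPattern k c x = ε} =
      ⋂ i, {x | haar ((∑ j, x j * (k i j : ℝ)) + c i) = ((ε i : ℤ) : ℝ)} := by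
    ext x
    simp [signPattern, haar_eq_coe_iff, funext_iff]
  rw [this]
  refine MeasurableSet.iInter fun i => ?_
  refine (measurable_haar.comp ?_) (measurableSet_singleton _)
  fun_prop

theorem measurable_comp_waveGradient (f : Matrix (Fin m) (Fin n) ℝ → ℝ)
    (a : Fin N → Fin m → ℝ) (k : Fin N → Fin n → ℤ) (c : Fin N → ℝ) :
    Measurable fun x => f (waveGradient a k c x) := by
  let _ : MeasurableSpace (Fin N → ℤˣ) := ⊤
  have h : Measurable (signPattern k c) :=
    measurable_to_countable' fun ε => measurableSet_signPattern_eq k c ε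
  simp_rw [← node_signPattern]
  exact (measurable_from_top (f := fun ε => f (node a k ε))).comp h

/-- The gradient depends on `x` only through its sign pattern, so the integral is one over the
finite pushforward measure. No regularity of `f` is needed. -/
theorem integral_comp_waveGradient (f : Matrix (Fin m) (Fin n) ℝ → ℝ)
    (a : Fin N → Fin m → ℝ) (k : Fin N → Fin n → ℤ) (c : Fin N → ℝ) :
    ∫ x in unitCube n, f (waveGradient a k c x) = ∑ ε, weight k c ε * f (node a k ε) := by
  let _ : MeasurableSpace (Fin N → ℤˣ) := ⊤
  have _ : MeasurableSingletonClass (Fin N → ℤˣ) := ⟨fun _ => trivial⟩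
  have h : Measurable (signPattern k c) :=
    measurable_to_countable' fun ε => measurableSet_signPattern_eq k c ε
  simp_rw [← node_signPattern]
  have _ := Measure.isProbabilityMeasure_map (μ := volume.restrict (unitCube n)) h.aemeasurable
  rw [← integral_map (f := fun ε => f (node a k ε)) h.aemeasurable
    (measurable_from_top.aestronglyMeasurable),
    integral_fintype (Integrable.of_finite)]
  refine Finset.sum_congr rfl fun ε _ => ?_
  rw [smul_eq_mul, weight, measureReal_def, Measure.map_apply h (measurableSet_singleton ε),
    Measure.restrict_apply (h (measurableSet_singleton ε))]
  congr 3
  ext x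
  simp [signPattern, haar_eq_coe_iff, funext_iff, and_comm]

theorem waveQuasiconvex_iff (f : Matrix (Fin m) (Fin n) ℝ → ℝ) :
    WaveQuasiconvex N f ↔ ∀ A (a : Fin N → Fin m → ℝ) (k : Fin N → Fin n → ℤ) (c : Fin N → ℝ),
      f A ≤ ∫ x in unitCube n, f (A + waveGradient a k c x) := by
  constructor
  · intro h A a k c
    have := h (-A) a k c
    rw [integral_comp_waveGradient (fun B => f (A + B))]
    simpa only [sub_neg_eq_add, zero_add, add_comm A] using this
  · intro h A a k c
    have := h (-A) a k c
    rw [integral_comp_waveGradient (fun B => f (-A + B))] at this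
    simpa only [zero_sub, neg_add_eq_sub] using this

end Waves

/-! ### From rank-one midpoint convexity to continuity and limits of integrals. -/

section Continuity

open MeasureTheory Filter Topology

variable {m n : ℕ}

/-- Midpoint convexity along the rank-one directions `a ⊗ eⱼ`. -/
def MidpointConvexAlongAxes (f : Matrix (Fin m) (Fin n) ℝ → ℝ) : Prop :=
  ∀ (A : Matrix (Fin m) (Fin n) ℝ) (a : Fin m → ℝ) (j : Fin n),
    f A ≤ (f (A + Matrix.vecMulVec a (Pi.single j 1)) +
      f (A - Matrix.vecMulVec a (Pi.single j 1))) / 2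

/-- The matrix units `eᵢ ⊗ eⱼ` have rank one, so the matrix entries serve as the coordinates of
separate midpoint convexity. -/
theorem MidpointConvexAlongAxes.continuous {f : Matrix (Fin m) (Fin n) ℝ → ℝ}
    (hmid : MidpointConvexAlongAxes f) (hf : Measurable[borel (Matrix (Fin m) (Fin n) ℝ)] f) :
    Continuous f := by
  let E : (Fin m × Fin n → ℝ) → Matrix (Fin m) (Fin n) ℝ := fun y => Matrix.of fun i j => y (i, j)
  have hE : Continuous E := continuous_matrix fun i j => continuous_apply (i, j)
  have hm : Measurable (f ∘ E) := by
    let _ : MeasurableSpace (Matrix (Fin m) (Fin n) ℝ) := borel _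
    have _ : BorelSpace (Matrix (Fin m) (Fin n) ℝ) := ⟨rfl⟩
    exact Measurable.comp hf hE.measurable
  have hs : SeparatelyMidpointConvex (f ∘ E) := by
    rintro y ⟨i, j⟩ t
    have h := hmid (E y) (Pi.single i t) j
    have e : Matrix.vecMulVec (Pi.single i t) (Pi.single j 1) = E (Pi.single (i, j) t) := by
      ext i' j'
      simp only [E, Matrix.vecMulVec_apply, Matrix.of_apply, Pi.single_apply, Prod.mk.injEq]
      split_ifs <;> simp_all
    rw [e] at h
    exact h
  have hc := hs.continuous hm
  have : f = (f ∘ E) ∘ fun A p => A p.1 p.2 := by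
    funext A
    rfl
  rw [this]
  exact hc.comp (continuous_pi fun p => continuous_id.matrix_elem p.1 p.2)

theorem isCompact_setOf_abs_le (C : ℝ) :
    IsCompact {A : Matrix (Fin m) (Fin n) ℝ | ∀ i j, |A i j| ≤ C} := by
  have h : IsCompact (Set.univ.pi fun _ : Fin m => Set.univ.pi fun _ : Fin n => Set.Icc (-C) C) :=
    isCompact_univ_pi fun _ => isCompact_univ_pi fun _ => isCompact_Icc
  have e : {A : Matrix (Fin m) (Fin n) ℝ | ∀ i j, |A i j| ≤ C} =
      Set.univ.pi fun _ : Fin m => Set.univ.pi fun _ : Fin n => Set.Icc (-C) C :=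
    Set.ext fun A => ⟨fun h i _ j _ => abs_le.1 (h i j),
      fun h i j => abs_le.2 (h i trivial j trivial)⟩
  exact e ▸ h

theorem exists_bound_of_abs_le {f : Matrix (Fin m) (Fin n) ℝ → ℝ} (hf : Continuous f) (C : ℝ) :
    ∃ M, ∀ A : Matrix (Fin m) (Fin n) ℝ, (∀ i j, |A i j| ≤ C) → |f A| ≤ M :=
  (isCompact_setOf_abs_le C).exists_bound_of_continuousOn hf.continuousOn

theorem tendsto_integral_unitCube_comp {f : Matrix (Fin m) (Fin n) ℝ → ℝ} (hf : Continuous f)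
    {Y : ℕ → (Fin n → ℝ) → Matrix (Fin m) (Fin n) ℝ} {Z : (Fin n → ℝ) → Matrix (Fin m) (Fin n) ℝ}
    {C : ℝ} (hC : ∀ l x i j, |Y l x i j| ≤ C)
    (hm : ∀ l, AEStronglyMeasurable (fun x => f (Y l x)) (volume.restrict (unitCube n)))
    (hlim : ∀ x i j, Tendsto (fun l => Y l x i j) atTop (𝓝 (Z x i j))) :
    Tendsto (fun l => ∫ x in unitCube n, f (Y l x)) atTop (𝓝 (∫ x in unitCube n, f (Z x))) := by
  obtain ⟨M, hM⟩ := exists_bound_of_abs_le hf C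
  refine tendsto_integral_of_dominated_convergence (fun _ => M) hm (integrable_const M)
    (fun l => ae_of_all _ fun x => hM _ (hC l x)) (ae_of_all _ fun x => ?_)
  exact (hf.tendsto _).comp (tendsto_pi_nhds.2 fun i => tendsto_pi_nhds.2 fun j => hlim x i j)

/-- A single unshifted wave of frequency `eⱼ` has gradient `a ⊗ eⱼ` on one half of the cube and its
negative on the other. -/
theorem WaveQuasiconvex.midpointConvexAlongAxes {f : Matrix (Fin m) (Fin n) ℝ → ℝ}
    (h : WaveQuasiconvex 1 f) : MidpointConvexAlongAxes f := by
  intro A a j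
  have h1 := (waveQuasiconvex_iff f).1 h A (fun _ => a) (fun _ => Pi.single j 1) (fun _ => 0)
  have e : ∀ x : Fin n → ℝ, waveGradient (fun _ : Fin 1 => a) (fun _ => Pi.single j 1)
      (fun _ => 0) x = haar (x j) • Matrix.vecMulVec a (Pi.single j 1) := by
    intro x
    have : (fun i => ((Pi.single j 1 : Fin n → ℤ) i : ℝ)) = Pi.single j 1 := by
      funext i
      by_cases hi : i = j
      · subst hi; simp
      · simp [hi]
    have hx : ∑ i, x i * ((Pi.single j 1 : Fin n → ℤ) i : ℝ) = x j := by
      simp [Pi.single_apply]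
    simp [waveGradient, this, hx]
  simp_rw [e] at h1
  set X : Matrix (Fin m) (Fin n) ℝ := Matrix.vecMulVec a (Pi.single j 1)
  have hmeas : Measurable fun t => f (A + haar t • X) := by
    have : (fun t => f (A + haar t • X)) =
        fun t => if Int.fract t < 1 / 2 then f (A + X) else f (A - X) := by
      funext t
      unfold haar
      split_ifs <;> simp [sub_eq_add_neg]
    rw [this]
    exact Measurable.ite (measurableSet_lt measurable_fract measurable_const) measurable_const
      measurable_const
  have h2 : ∫ x in unitCube n, f (A + haar (x j) • X) =
      ∫ t in Set.Ico (0 : ℝ) 1, f (A + haar t • X) := by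
    rw [← (measurePreserving_eval_unitCube j).map_eq, integral_map
      (measurable_pi_apply j).aemeasurable hmeas.aestronglyMeasurable]
  have hl : Set.EqOn (fun t => f (A + haar t • X)) (fun _ => f (A + X))
      (Set.Ico (0 : ℝ) (1 / 2)) := by
    intro t ht
    have : Int.fract t = t := Int.fract_eq_self.2 ⟨ht.1, by linarith [ht.2]⟩
    have : haar t = 1 := by rw [haar, this, if_pos ht.2]
    simp [this]
  have hr : Set.EqOn (fun t => f (A + haar t • X)) (fun _ => f (A - X))
      (Set.Ico (1 / 2 : ℝ) 1) := by
    intro t ht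
    have : Int.fract t = t := Int.fract_eq_self.2 ⟨by linarith [ht.1], ht.2⟩
    have : haar t = -1 := by rw [haar, this, if_neg (not_lt.2 ht.1)]
    simp [this, sub_eq_add_neg]
  have h3 : ∫ t in Set.Ico (0 : ℝ) 1, f (A + haar t • X) = (f (A + X) + f (A - X)) / 2 := by
    rw [← Set.Ico_union_Ico_eq_Ico (show (0 : ℝ) ≤ 1 / 2 by norm_num) (by norm_num),
      setIntegral_union (Set.Ico_disjoint_Ico_same) measurableSet_Ico
      ((integrableOn_congr_fun hl measurableSet_Ico).2 (by simp))
      ((integrableOn_congr_fun hr measurableSet_Ico).2 (by simp)),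
      setIntegral_congr_fun measurableSet_Ico hl, setIntegral_congr_fun measurableSet_Ico hr]
    norm_num
    ring
  rwa [h2, h3] at h1

end Continuity

/-! ### A smooth periodic square wave and its primitive. -/

section SmoothSquare

open MeasureTheory Filter Topology

/-- At an integer the two branches join smoothly, since `g` equals `c` at the end of the period and
also to the left of `0`. Hence the composite agrees near `t₀` with the single translate `g (t -
⌊t₀⌋)`. -/
theorem contDiff_comp_fract {g : ℝ → ℝ} (hg : ContDiff ℝ ∞ g) {b c : ℝ} (hb : b < 1)
    (h0 : ∀ t ≤ 0, g t = c) (h1 : ∀ t, b ≤ t → g t = c) :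
    ContDiff ℝ ∞ fun t => g (Int.fract t) := by
  rw [contDiff_iff_contDiffAt]
  intro t₀
  have hs : ContDiffAt ℝ ∞ (fun t => g (t - ⌊t₀⌋)) t₀ :=
    (hg.comp (contDiff_id.sub contDiff_const)).contDiffAt
  refine hs.congr_of_eventuallyEq ?_
  have hl := Int.floor_le t₀
  have hu := Int.lt_floor_add_one t₀
  filter_upwards [Ioo_mem_nhds (show (⌊t₀⌋ : ℝ) - (1 - b) < t₀ by linarith) hu,
    Ioi_mem_nhds (show (⌊t₀⌋ : ℝ) - 1 < t₀ by linarith)] with t ht ht'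
  rcases le_or_gt (⌊t₀⌋ : ℝ) t with h | h
  · have : ⌊t⌋ = ⌊t₀⌋ := Int.floor_eq_iff.2 ⟨h, ht.2⟩
    rw [← Int.self_sub_floor, this]
  · have : ⌊t⌋ = ⌊t₀⌋ - 1 := Int.floor_eq_iff.2
      ⟨by push_cast; exact (Set.mem_Ioi.1 ht').le, by push_cast; linarith⟩
    rw [← Int.self_sub_floor, this, h0 (t - ⌊t₀⌋) (by linarith),
      h1 _ (by push_cast; linarith [ht.1])]

/-- A smooth step profile on `[0, 1]`: it climbs from `-1` to `1` on `[0, δ]` and returns on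
`[1/2, 1/2 + δ]`. -/
noncomputable def stepProfile (δ t : ℝ) : ℝ :=
  2 * Real.smoothTransition (t / δ) - 2 * Real.smoothTransition ((t - 1 / 2) / δ) - 1

theorem contDiff_stepProfile (δ : ℝ) : ContDiff ℝ ∞ (stepProfile δ) := by
  have h : ContDiff ℝ ∞ Real.smoothTransition := Real.smoothTransition.contDiff
  unfold stepProfile
  refine ((contDiff_const.mul (h.comp ?_)).sub (contDiff_const.mul (h.comp ?_))).sub contDiff_const
  · exact contDiff_id.div_const δ
  · exact (contDiff_id.sub contDiff_const).div_const δ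

variable {δ : ℝ}

theorem stepProfile_of_nonpos (hδ : 0 < δ) {t : ℝ} (ht : t ≤ 0) : stepProfile δ t = -1 := by
  rw [stepProfile, Real.smoothTransition.zero_of_nonpos (div_nonpos_of_nonpos_of_nonneg ht hδ.le),
    Real.smoothTransition.zero_of_nonpos
      (div_nonpos_of_nonpos_of_nonneg (by linarith) hδ.le)]
  norm_num

theorem stepProfile_of_le_half (hδ : 0 < δ) {t : ℝ} (ht : t ≤ 1 / 2) :
    stepProfile δ t = 2 * Real.smoothTransition (t / δ) - 1 := by
  rw [stepProfile, Real.smoothTransition.zero_of_nonpos (x := (t - 1 / 2) / δ)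
      (div_nonpos_of_nonpos_of_nonneg (by linarith) hδ.le)]
  norm_num

theorem stepProfile_of_delta_le (hδ : 0 < δ) {t : ℝ} (ht : δ ≤ t) :
    stepProfile δ t = 1 - 2 * Real.smoothTransition ((t - 1 / 2) / δ) := by
  rw [stepProfile, Real.smoothTransition.one_of_one_le ((one_le_div hδ).2 ht)]
  ring

theorem stepProfile_eq_one (hδ : 0 < δ) {t : ℝ} (ht : δ ≤ t) (ht' : t ≤ 1 / 2) :
    stepProfile δ t = 1 := by
  rw [stepProfile_of_le_half hδ ht', Real.smoothTransition.one_of_one_le ((one_le_div hδ).2 ht)]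
  norm_num

theorem stepProfile_eq_neg_one (hδ : 0 < δ) (hδ' : δ < 1 / 2) {t : ℝ} (ht : 1 / 2 + δ ≤ t) :
    stepProfile δ t = -1 := by
  rw [stepProfile_of_delta_le hδ (by linarith),
    Real.smoothTransition.one_of_one_le ((one_le_div hδ).2 (by linarith))]
  norm_num

theorem abs_stepProfile_le (hδ : 0 < δ) (hδ' : δ < 1 / 2) (t : ℝ) : |stepProfile δ t| ≤ 1 := by
  rw [abs_le]
  rcases le_total t (1 / 2) with h | h
  · rw [stepProfile_of_le_half hδ h]
    have h1 := Real.smoothTransition.nonneg (t / δ)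
    have h2 := Real.smoothTransition.le_one (t / δ)
    constructor <;> linarith
  · rw [stepProfile_of_delta_le hδ (by linarith)]
    have h1 := Real.smoothTransition.nonneg ((t - 1 / 2) / δ)
    have h2 := Real.smoothTransition.le_one ((t - 1 / 2) / δ)
    constructor <;> linarith

/-- A smooth `1`-periodic approximation of the Haar wavelet. -/
noncomputable def smoothSquare (δ t : ℝ) : ℝ := stepProfile δ (Int.fract t)

theorem contDiff_smoothSquare (hδ : 0 < δ) (hδ' : δ < 1 / 2) : ContDiff ℝ ∞ (smoothSquare δ) :=
  contDiff_comp_fract (contDiff_stepProfile δ) (b := 1 / 2 + δ) (c := -1) (by linarith)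
    (fun _ ht => stepProfile_of_nonpos hδ ht) (fun _ ht => stepProfile_eq_neg_one hδ hδ' ht)

theorem periodic_smoothSquare (δ : ℝ) : Function.Periodic (smoothSquare δ) 1 := fun t => by
  simp [smoothSquare]

theorem smoothSquare_eq_of_mem_Icc (hδ : 0 < δ) (hδ' : δ < 1 / 2) {t : ℝ}
    (ht : t ∈ Set.Icc (0 : ℝ) 1) : smoothSquare δ t = stepProfile δ t := by
  rcases ht.2.lt_or_eq with h | rfl
  · rw [smoothSquare, Int.fract_eq_self.2 ⟨ht.1, h⟩]
  · rw [smoothSquare, Int.fract_one, stepProfile_of_nonpos hδ le_rfl,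
      stepProfile_eq_neg_one hδ hδ' (by linarith)]

/-- The shift by `δ` moves each point past the ramp that starts at a jump, so convergence holds at
every `t`, the jumps included; the values are even eventually equal. -/
theorem tendsto_smoothSquare_haar (t : ℝ) :
    Tendsto (fun δ => smoothSquare δ (t + δ)) (𝓝[>] 0) (𝓝 (haar t)) := by
  have h0 := Int.fract_nonneg t
  have h1 := Int.fract_lt_one t
  have key : ∀ δ : ℝ, 0 < δ → Int.fract t + δ < 1 → Int.fract (t + δ) = Int.fract t + δ := by
    intro δ hδ h
    rw [← Int.self_sub_floor t, ← Int.self_sub_floor (t + δ),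
      Int.floor_eq_iff.2 (⟨?_, ?_⟩ : (⌊t⌋ : ℝ) ≤ t + δ ∧ t + δ < ⌊t⌋ + 1)]
    · ring
    · linarith [Int.floor_le t]
    · linarith [Int.self_sub_floor t]
  refine tendsto_nhds_of_eventually_eq ?_
  by_cases h : Int.fract t < 1 / 2
  · filter_upwards [Ioo_mem_nhdsGT (show 0 < 1 / 2 - Int.fract t by linarith)] with δ hδ
    rw [smoothSquare, key δ hδ.1 (by linarith [hδ.2]), haar, if_pos h,
      stepProfile_eq_one hδ.1 (by linarith) (by linarith [hδ.2])]
  · rw [not_lt] at h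
    filter_upwards [Ioo_mem_nhdsGT (show 0 < 1 - Int.fract t by linarith),
      Ioo_mem_nhdsGT (show (0 : ℝ) < 1 / 2 by norm_num)] with δ hδ hδ'
    rw [smoothSquare, key δ hδ.1 (by linarith [hδ.2]), haar, if_neg (not_lt.2 h),
      stepProfile_eq_neg_one hδ.1 hδ'.2 (by linarith)]

/-- Rescaling the two ramps to `[0, 1]` makes the dependence on `δ` explicit. The limit `δ → 0` then
needs no bound on `F`. -/
theorem integral_comp_smoothSquare (hδ : 0 < δ) (hδ' : δ < 1 / 2) {F : ℝ → ℝ}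
    (hF : IntegrableOn (fun t => F (smoothSquare δ t)) (Set.Ico 0 1)) :
    ∫ t in Set.Ico 0 1, F (smoothSquare δ t) =
      δ * ((∫ r in (0 : ℝ)..1, F (2 * Real.smoothTransition r - 1)) +
        ∫ r in (0 : ℝ)..1, F (1 - 2 * Real.smoothTransition r)) +
      (1 / 2 - δ) * (F 1 + F (-1)) := by
  have hI : IntervalIntegrable (fun t => F (smoothSquare δ t)) volume 0 1 := by
    rw [intervalIntegrable_iff_integrableOn_Ico_of_le zero_le_one]
    exact hF
  have hH : IntervalIntegrable (fun t => F (stepProfile δ t)) volume 0 1 := by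
    refine hI.congr fun t ht => ?_
    rw [Set.uIoc_of_le zero_le_one] at ht
    simp only [smoothSquare_eq_of_mem_Icc hδ hδ' ⟨ht.1.le, ht.2⟩]
  have hsub : ∀ a b : ℝ, 0 ≤ a → a ≤ b → b ≤ 1 →
      IntervalIntegrable (fun t => F (stepProfile δ t)) volume a b := by
    intro a b ha hab hb
    refine hH.mono_set ?_
    rw [Set.uIcc_of_le hab, Set.uIcc_of_le zero_le_one]
    exact Set.Icc_subset_Icc ha hb
  rw [setIntegral_congr_set Ico_ae_eq_Ioc, ← intervalIntegral.integral_of_le zero_le_one]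
  have e0 : ∫ t in (0 : ℝ)..1, F (smoothSquare δ t) = ∫ t in (0 : ℝ)..1, F (stepProfile δ t) := by
    refine intervalIntegral.integral_congr fun t ht => ?_
    rw [Set.uIcc_of_le zero_le_one] at ht
    simp only [smoothSquare_eq_of_mem_Icc hδ hδ' ht]
  have e1 : ∫ t in (0 : ℝ)..δ, F (stepProfile δ t) =
      δ * ∫ r in (0 : ℝ)..1, F (2 * Real.smoothTransition r - 1) := by
    have : ∫ t in (0 : ℝ)..δ, F (stepProfile δ t) =
        ∫ t in (0 : ℝ)..δ, F (2 * Real.smoothTransition (t / δ) - 1) := by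
      refine intervalIntegral.integral_congr fun t ht => ?_
      rw [Set.uIcc_of_le hδ.le] at ht
      simp only [stepProfile_of_le_half hδ (show t ≤ 1 / 2 by linarith [ht.2])]
    rw [this, intervalIntegral.integral_comp_div
      (fun r => F (2 * Real.smoothTransition r - 1)) hδ.ne', zero_div, div_self hδ.ne', smul_eq_mul]
  have e2 : ∫ t in δ..(1 / 2), F (stepProfile δ t) = (1 / 2 - δ) * F 1 := by
    have : ∫ t in δ..(1 / 2), F (stepProfile δ t) = ∫ t in δ..(1 / 2), F 1 := by
      refine intervalIntegral.integral_congr fun t ht => ?_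
      rw [Set.uIcc_of_le hδ'.le] at ht
      simp only [stepProfile_eq_one hδ ht.1 ht.2]
    rw [this, intervalIntegral.integral_const, smul_eq_mul]
  have e3 : ∫ t in (1 / 2)..(1 / 2 + δ), F (stepProfile δ t) =
      δ * ∫ r in (0 : ℝ)..1, F (1 - 2 * Real.smoothTransition r) := by
    have : ∫ t in (1 / 2)..(1 / 2 + δ), F (stepProfile δ t) =
        ∫ t in (1 / 2)..(1 / 2 + δ), F (1 - 2 * Real.smoothTransition ((t - 1 / 2) / δ)) := by
      refine intervalIntegral.integral_congr fun t ht => ?_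
      rw [Set.uIcc_of_le (by linarith)] at ht
      simp only [stepProfile_of_delta_le hδ (show δ ≤ t by linarith [ht.1])]
    rw [this, intervalIntegral.integral_comp_sub_right
      (fun t => F (1 - 2 * Real.smoothTransition (t / δ))), intervalIntegral.integral_comp_div
      (fun r => F (1 - 2 * Real.smoothTransition r)) hδ.ne', sub_self, add_sub_cancel_left,
      zero_div, div_self hδ.ne', smul_eq_mul]
  have e4 : ∫ t in (1 / 2 + δ)..1, F (stepProfile δ t) = (1 / 2 - δ) * F (-1) := by
    have : ∫ t in (1 / 2 + δ)..1, F (stepProfile δ t) = ∫ t in (1 / 2 + δ)..1, F (-1) := by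
      refine intervalIntegral.integral_congr fun t ht => ?_
      rw [Set.uIcc_of_le (by linarith)] at ht
      simp only [stepProfile_eq_neg_one hδ hδ' ht.1]
    rw [this, intervalIntegral.integral_const, smul_eq_mul]
    ring
  rw [e0, ← intervalIntegral.integral_add_adjacent_intervals
      (hsub 0 (1 / 2) le_rfl (by norm_num) (by norm_num))
      (hsub (1 / 2) 1 (by norm_num) (by norm_num) le_rfl),
    ← intervalIntegral.integral_add_adjacent_intervals
      (hsub 0 δ le_rfl hδ.le (by linarith)) (hsub δ (1 / 2) hδ.le hδ'.le (by norm_num)),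
    ← intervalIntegral.integral_add_adjacent_intervals
      (hsub (1 / 2) (1 / 2 + δ) (by norm_num) (by linarith) (by linarith))
      (hsub (1 / 2 + δ) 1 (by linarith) (by linarith) le_rfl), e1, e2, e3, e4]
  ring

/-- The ramps are negatives of each other after translation, so they cancel. Zero mean is what makes
the primitive periodic. -/
theorem integral_smoothSquare (hδ : 0 < δ) (hδ' : δ < 1 / 2) :
    ∫ t in (0 : ℝ)..1, smoothSquare δ t = 0 := by
  have hc := (contDiff_smoothSquare hδ hδ').continuous
  have h := integral_comp_smoothSquare hδ hδ' (F := id)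
    (hc.integrableOn_Icc.mono_set Set.Ico_subset_Icc_self)
  rw [setIntegral_congr_set Ico_ae_eq_Ioc, ← intervalIntegral.integral_of_le zero_le_one] at h
  simp only [id] at h
  have hn : ∫ r in (0 : ℝ)..1, (1 - 2 * Real.smoothTransition r) =
      -∫ r in (0 : ℝ)..1, (2 * Real.smoothTransition r - 1) := by
    rw [← intervalIntegral.integral_neg]
    simp only [neg_sub]
  rw [h, hn]
  ring

/-- The smooth `1`-periodic primitive of `smoothSquare`. -/
noncomputable def smoothSawtooth (δ t : ℝ) : ℝ := ∫ r in (0 : ℝ)..t, smoothSquare δ r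

theorem hasDerivAt_smoothSawtooth (hδ : 0 < δ) (hδ' : δ < 1 / 2) (t : ℝ) :
    HasDerivAt (smoothSawtooth δ) (smoothSquare δ t) t :=
  (contDiff_smoothSquare hδ hδ').continuous.integral_hasStrictDerivAt 0 t |>.hasDerivAt

theorem contDiff_smoothSawtooth (hδ : 0 < δ) (hδ' : δ < 1 / 2) :
    ContDiff ℝ ∞ (smoothSawtooth δ) := by
  rw [contDiff_infty_iff_deriv]
  refine ⟨fun t => (hasDerivAt_smoothSawtooth hδ hδ' t).differentiableAt, ?_⟩
  rw [funext fun t => (hasDerivAt_smoothSawtooth hδ hδ' t).deriv]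
  exact contDiff_smoothSquare hδ hδ'

theorem periodic_smoothSawtooth (hδ : 0 < δ) (hδ' : δ < 1 / 2) :
    Function.Periodic (smoothSawtooth δ) 1 := fun t => by
  have hc := (contDiff_smoothSquare hδ hδ').continuous
  have h := (periodic_smoothSquare δ).intervalIntegral_add_eq t 0
  rw [zero_add, integral_smoothSquare hδ hδ'] at h
  rw [smoothSawtooth, ← intervalIntegral.integral_add_adjacent_intervals
    (hc.intervalIntegrable 0 t) (hc.intervalIntegrable t (t + 1)), h, add_zero, smoothSawtooth]

end SmoothSquare

/-! ### Smooth waves as test maps: quasiconvexity implies wave quasiconvexity. -/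

section SmoothWaves

open MeasureTheory Filter Topology

variable {m n N : ℕ} {δ : ℝ}

/-- A sum of smoothed sawtooth plane waves. -/
noncomputable def smoothWave (δ : ℝ) (a : Fin N → Fin m → ℝ) (k : Fin N → Fin n → ℤ)
    (c : Fin N → ℝ) (x : Fin n → ℝ) : Fin m → ℝ :=
  ∑ l, smoothSawtooth δ ((∑ j, x j * (k l j : ℝ)) + c l) • a l

/-- The gradient of a sum of smoothed sawtooth plane waves. -/
noncomputable def smoothWaveGradient (δ : ℝ) (a : Fin N → Fin m → ℝ) (k : Fin N → Fin n → ℤ)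
    (c : Fin N → ℝ) (x : Fin n → ℝ) : Matrix (Fin m) (Fin n) ℝ :=
  ∑ l, smoothSquare δ ((∑ j, x j * (k l j : ℝ)) + c l) •
    Matrix.vecMulVec (a l) (fun j => (k l j : ℝ))

theorem contDiff_smoothWave (hδ : 0 < δ) (hδ' : δ < 1 / 2) (a : Fin N → Fin m → ℝ)
    (k : Fin N → Fin n → ℤ) (c : Fin N → ℝ) : ContDiff ℝ ∞ (smoothWave δ a k c) := by
  refine ContDiff.sum fun l _ => ((contDiff_smoothSawtooth hδ hδ').comp ?_).smul contDiff_const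
  fun_prop

theorem isPeriodic_smoothWave (hδ : 0 < δ) (hδ' : δ < 1 / 2) (a : Fin N → Fin m → ℝ)
    (k : Fin N → Fin n → ℤ) (c : Fin N → ℝ) : IsPeriodic (smoothWave δ a k c) := by
  intro x z
  refine Finset.sum_congr rfl fun l _ => ?_
  have : (∑ j, (x + fun j => (z j : ℝ)) j * (k l j : ℝ)) + c l =
      ((∑ j, x j * (k l j : ℝ)) + c l) + ((∑ j, z j * k l j : ℤ) : ℝ) * 1 := by
    push_cast
    simp only [Pi.add_apply, add_mul, Finset.sum_add_distrib]
    ring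
  rw [this, (periodic_smoothSawtooth hδ hδ').int_mul]

theorem jacobian_smoothWave (hδ : 0 < δ) (hδ' : δ < 1 / 2) (a : Fin N → Fin m → ℝ)
    (k : Fin N → Fin n → ℤ) (c : Fin N → ℝ) (x : Fin n → ℝ) :
    jacobian (smoothWave δ a k c) x = smoothWaveGradient δ a k c x := by
  have hL : ∀ l, HasFDerivAt (fun x : Fin n → ℝ => (∑ j, x j * (k l j : ℝ)) + c l)
      (∑ j, (k l j : ℝ) • ContinuousLinearMap.proj (R := ℝ) (φ := fun _ : Fin n => ℝ) j) x := by
    intro l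
    refine (HasFDerivAt.fun_sum fun j _ => ?_).add_const (c l)
    exact (hasFDerivAt_apply j x).mul_const (k l j : ℝ)
  have hd := HasFDerivAt.fun_sum (u := Finset.univ) fun l _ =>
    ((hasDerivAt_smoothSawtooth hδ hδ' _).comp_hasFDerivAt x (hL l)).smul_const (a l)
  ext i j
  rw [jacobian, Matrix.of_apply]
  have hd' : HasFDerivAt (smoothWave δ a k c) _ x := hd
  rw [hd'.fderiv]
  simp [smoothWaveGradient, Matrix.sum_apply, Matrix.vecMulVec_apply, Pi.single_apply]
  exact Finset.sum_congr rfl fun l _ => by ring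

theorem continuous_smoothWaveGradient (hδ : 0 < δ) (hδ' : δ < 1 / 2) (a : Fin N → Fin m → ℝ)
    (k : Fin N → Fin n → ℤ) (c : Fin N → ℝ) : Continuous (smoothWaveGradient δ a k c) := by
  refine continuous_finsetSum _ fun l _ => Continuous.fun_smul ?_ continuous_const
  exact (contDiff_smoothSquare hδ hδ').continuous.comp (by fun_prop)

theorem abs_smoothWaveGradient_le (hδ : 0 < δ) (hδ' : δ < 1 / 2) (a : Fin N → Fin m → ℝ)
    (k : Fin N → Fin n → ℤ) (c : Fin N → ℝ) (x : Fin n → ℝ) (i : Fin m) (j : Fin n) :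
    |smoothWaveGradient δ a k c x i j| ≤ ∑ l, |a l i * (k l j : ℝ)| := by
  rw [smoothWaveGradient, Matrix.sum_apply]
  refine (Finset.abs_sum_le_sum_abs _ _).trans (Finset.sum_le_sum fun l _ => ?_)
  rw [Matrix.smul_apply, smul_eq_mul, abs_mul, Matrix.vecMulVec_apply]
  exact mul_le_of_le_one_left (abs_nonneg _) (abs_stepProfile_le hδ hδ' _)

/-- Here `f` is not yet known to be locally bounded. The integrability demanded by quasiconvexity
justifies the exact formula for one smoothed wave, which is affine in `δ`. -/
theorem Quasiconvex.midpointConvexAlongAxes {f : Matrix (Fin m) (Fin n) ℝ → ℝ}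
    (h : Quasiconvex f) (hf : Measurable[borel (Matrix (Fin m) (Fin n) ℝ)] f) :
    MidpointConvexAlongAxes f := by
  intro A a j
  set X : Matrix (Fin m) (Fin n) ℝ := Matrix.vecMulVec a (Pi.single j 1) with hX
  set F : ℝ → ℝ := fun t => f (A + t • X) with hF
  have hFm : Measurable F := by
    let _ : MeasurableSpace (Matrix (Fin m) (Fin n) ℝ) := borel _
    have _ : BorelSpace (Matrix (Fin m) (Fin n) ℝ) := ⟨rfl⟩
    exact Measurable.comp hf
      (continuous_const.add (continuous_id.smul continuous_const)).measurable
  have key : ∀ δ : ℝ, 0 < δ → δ < 1 / 2 → F 0 ≤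
      δ * ((∫ r in (0 : ℝ)..1, F (2 * Real.smoothTransition r - 1)) +
        ∫ r in (0 : ℝ)..1, F (1 - 2 * Real.smoothTransition r)) +
      (1 / 2 - δ) * (F 1 + F (-1)) := by
    intro δ hδ hδ'
    obtain ⟨h1, h2⟩ := h A
      (smoothWave δ (fun _ : Fin 1 => a) (fun _ => Pi.single j 1) (fun _ => 0))
      (contDiff_smoothWave hδ hδ' _ _ _) (isPeriodic_smoothWave hδ hδ' _ _ _)
    have e : ∀ x : Fin n → ℝ, f (A + jacobian (smoothWave δ (fun _ : Fin 1 => a)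
        (fun _ => Pi.single j 1) (fun _ => 0)) x) = F (smoothSquare δ (x j)) := by
      intro x
      have h1 : (fun i => ((Pi.single j 1 : Fin n → ℤ) i : ℝ)) = Pi.single j 1 := by
        funext i
        by_cases hi : i = j
        · subst hi; simp
        · simp [hi]
      have h2 : ∑ i, x i * ((Pi.single j 1 : Fin n → ℤ) i : ℝ) = x j := by
        simp [Pi.single_apply]
      rw [jacobian_smoothWave hδ hδ']
      simp [smoothWaveGradient, h1, h2, hF, hX]
    simp_rw [e] at h1 h2
    have hm : AEStronglyMeasurable (fun t => F (smoothSquare δ t))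
        ((volume : Measure ℝ).restrict (Set.Ico 0 1)) :=
      (hFm.comp (contDiff_smoothSquare hδ hδ').continuous.measurable).aestronglyMeasurable
    have hp := measurePreserving_eval_unitCube j
    have h3 : IntegrableOn (fun t => F (smoothSquare δ t)) (Set.Ico 0 1) :=
      (hp.integrable_comp hm).1 h1
    rw [← integral_comp_smoothSquare hδ hδ' h3, ← hp.map_eq,
      integral_map hp.aemeasurable (hp.map_eq.symm ▸ hm)]
    simpa [hF] using h2
  have hlim := ge_of_tendsto (x := 𝓝[>] (0 : ℝ)) (b := F 0)
    (f := fun δ => δ * ((∫ r in (0 : ℝ)..1, F (2 * Real.smoothTransition r - 1)) +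
        ∫ r in (0 : ℝ)..1, F (1 - 2 * Real.smoothTransition r)) +
      (1 / 2 - δ) * (F 1 + F (-1)))
    ((Continuous.tendsto (by fun_prop) 0).mono_left nhdsWithin_le_nhds) (by
      filter_upwards [Ioo_mem_nhdsGT (show (0 : ℝ) < 1 / 2 by norm_num)] with δ hδ
      exact key δ hδ.1 hδ.2)
  simp only [hF, zero_smul, add_zero, zero_mul, zero_add, sub_zero, one_smul, neg_smul,
    ← sub_eq_add_neg] at hlim
  linarith

theorem Quasiconvex.waveQuasiconvex {f : Matrix (Fin m) (Fin n) ℝ → ℝ}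
    (h : Quasiconvex f) (hf : Measurable[borel (Matrix (Fin m) (Fin n) ℝ)] f) (N : ℕ) :
    WaveQuasiconvex N f := by
  have hc := (h.midpointConvexAlongAxes hf).continuous hf
  rw [waveQuasiconvex_iff]
  intro A a k c
  have hcA : Continuous fun B => f (A + B) := hc.comp (continuous_const.add continuous_id)
  -- The offset `3` keeps every ramp width below `1 / 2`, already at `l = 0`.
  let d : ℕ → ℝ := fun l => 1 / (l + 3)
  have hd0 : ∀ l, 0 < d l := fun l => by positivity
  have hd1 : ∀ l, d l < 1 / 2 := fun l => by
    refine one_div_lt_one_div_of_lt two_pos ?_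
    have : (0 : ℝ) ≤ l := l.cast_nonneg
    linarith
  have hdlim : Tendsto d atTop (𝓝[>] 0) := by
    refine tendsto_nhdsWithin_iff.2 ⟨?_, Eventually.of_forall hd0⟩
    have h1 := (tendsto_const_div_atTop_nhds_zero_nat (1 : ℝ)).comp (tendsto_add_atTop_nat 3)
    refine h1.congr fun l => ?_
    simp [d]
  obtain ⟨C, hC⟩ : ∃ C, ∀ i j, ∑ l, |a l i * (k l j : ℝ)| ≤ C := by
    refine ⟨∑ i, ∑ j, ∑ l, |a l i * (k l j : ℝ)|, fun i j => ?_⟩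
    refine (Finset.single_le_sum (f := fun j => ∑ l, |a l i * (k l j : ℝ)|)
      (fun j _ => Finset.sum_nonneg fun l _ => abs_nonneg _) (Finset.mem_univ j)).trans ?_
    exact Finset.single_le_sum (f := fun i => ∑ j, ∑ l, |a l i * (k l j : ℝ)|)
      (fun i _ => Finset.sum_nonneg fun j _ => Finset.sum_nonneg fun l _ => abs_nonneg _)
      (Finset.mem_univ i)
  have hlim := tendsto_integral_unitCube_comp hcA (C := C)
    (Y := fun l => smoothWaveGradient (d l) a k (fun i => c i + d l)) (Z := waveGradient a k c)
    (fun l x i j => (abs_smoothWaveGradient_le (hd0 l) (hd1 l) a k _ x i j).trans (hC i j))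
    (fun l => (hcA.comp (continuous_smoothWaveGradient (hd0 l) (hd1 l) a k _)).aestronglyMeasurable)
    (fun x i j => by
      simp only [smoothWaveGradient, waveGradient, Matrix.sum_apply, Matrix.smul_apply]
      refine tendsto_finsetSum _ fun l _ => Tendsto.smul_const ?_ _
      simp_rw [← add_assoc]
      exact (tendsto_smoothSquare_haar _).comp hdlim)
  refine ge_of_tendsto' hlim fun l => ?_
  have := (h A _ (contDiff_smoothWave (hd0 l) (hd1 l) a k (fun i => c i + d l))
    (isPeriodic_smoothWave (hd0 l) (hd1 l) a k _)).2
  simpa only [jacobian_smoothWave (hd0 l) (hd1 l)] using this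

end SmoothWaves

/-! ### Uniform approximation of the cosine by translates of the Haar wavelet. -/

section Cosine

open Filter Topology

theorem haar_antiperiodic : Function.Antiperiodic haar (1 / 2) := by
  intro t
  have h0 := Int.fract_nonneg t
  have h1 := Int.fract_lt_one t
  have hs := Int.self_sub_floor t
  by_cases h : Int.fract t < 1 / 2
  · have : Int.fract (t + 1 / 2) = Int.fract t + 1 / 2 := by
      rw [Int.fract_eq_iff]
      exact ⟨by linarith, by linarith, ⌊t⌋, by linarith⟩
    rw [haar, haar, this, if_pos h, if_neg (by linarith)]
  · have : Int.fract (t + 1 / 2) = Int.fract t - 1 / 2 := by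
      rw [Int.fract_eq_iff]
      exact ⟨by linarith, by linarith, ⌊t⌋ + 1, by push_cast; linarith⟩
    rw [haar, haar, this, if_neg h, if_pos (by linarith), neg_neg]

theorem haar_of_mem_Ico {t : ℝ} (ht : t ∈ Set.Ico (0 : ℝ) (1 / 2)) : haar t = 1 := by
  rw [haar, Int.fract_eq_self.2 ⟨ht.1, by linarith [ht.2]⟩, if_pos ht.2]

theorem haar_of_mem_Ico_neg {t : ℝ} (ht : t ∈ Set.Ico (-1 / 2 : ℝ) 0) : haar t = -1 := by
  rw [← haar_of_mem_Ico (t := t + 1 / 2) ⟨by linarith [ht.1], by linarith [ht.2]⟩,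
    haar_antiperiodic, neg_neg]

/-- Linear combinations of translates of the Haar wavelet. -/
def haarSpan : Submodule ℝ (ℝ → ℝ) :=
  Submodule.span ℝ (Set.range fun (c : ℝ) (t : ℝ) => haar (t + c))

/-- An antiperiodic step function sampling the cosine at the points `i / (2 M)`. -/
noncomputable def cosStep (M : ℕ) (t : ℝ) : ℝ :=
  ∑ i ∈ Finset.range M, (Real.cos (2 * Real.pi * (i / (2 * M))) / 2) *
    (haar (t + -(i / (2 * M))) - haar (t + -((i + 1) / (2 * M))))

theorem cosStep_mem_haarSpan (M : ℕ) : cosStep M ∈ haarSpan := by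
  have : cosStep M = ∑ i ∈ Finset.range M, (Real.cos (2 * Real.pi * (i / (2 * M))) / 2) •
      ((fun t => haar (t + -(i / (2 * M)))) - fun t => haar (t + -((i + 1) / (2 * M)))) := by
    funext t
    simp [cosStep, Finset.sum_apply]
  rw [this]
  exact Submodule.sum_mem _ fun i _ => Submodule.smul_mem _ _
    (Submodule.sub_mem _ (Submodule.subset_span ⟨_, rfl⟩) (Submodule.subset_span ⟨_, rfl⟩))

theorem cosStep_antiperiodic (M : ℕ) : Function.Antiperiodic (cosStep M) (1 / 2) := by
  intro t
  rw [cosStep, cosStep, ← Finset.sum_neg_distrib]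
  refine Finset.sum_congr rfl fun i _ => ?_
  rw [add_right_comm t (1 / 2), add_right_comm t (1 / 2), haar_antiperiodic, haar_antiperiodic]
  ring

/-- On `[0, 1/2)` half the difference of two consecutive translates is the indicator of a cell of
length `1 / (2 * M)`. There `cosStep` samples the cosine at the left endpoint, and `2π` is a
Lipschitz constant. Antiperiodicity covers the other half period. -/
theorem abs_cos_sub_cosStep_le {M : ℕ} (hM : 0 < M) (t : ℝ) :
    |Real.cos (2 * Real.pi * t) - cosStep M t| ≤ Real.pi / M := by
  have hM' : (0 : ℝ) < M := by exact_mod_cast hM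
  have hper : Function.Periodic (fun t => |Real.cos (2 * Real.pi * t) - cosStep M t|) (1 / 2) := by
    intro t
    have h1 : Real.cos (2 * Real.pi * (t + 1 / 2)) = -Real.cos (2 * Real.pi * t) := by
      rw [← Real.cos_add_pi]
      congr 1
      ring
    simp only [h1, cosStep_antiperiodic M t]
    rw [← abs_neg]
    congr 1
    ring
  obtain ⟨u, hu, hut⟩ := hper.exists_mem_Ico₀ (by norm_num) t
  refine hut.le.trans ?_
  have hsign : ∀ p : ℝ, 0 ≤ p → p ≤ 1 / 2 → haar (u + -p) = if p ≤ u then 1 else -1 := by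
    intro p hp hp'
    split_ifs with h
    · exact haar_of_mem_Ico ⟨by linarith, by linarith [hu.2]⟩
    · exact haar_of_mem_Ico_neg ⟨by linarith [hu.1], by linarith⟩
  set l := ⌊2 * M * u⌋₊ with hl
  have hl0 : (l : ℝ) ≤ 2 * M * u := Nat.floor_le (by have := hu.1; positivity)
  have hl1 : 2 * M * u < l + 1 := Nat.lt_floor_add_one _
  have hlM : l < M := by
    have : (l : ℝ) < M := by nlinarith [hu.2]
    exact_mod_cast this
  have hle : ∀ i : ℕ, (i : ℝ) / (2 * M) ≤ u ↔ i ≤ l := by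
    intro i
    rw [div_le_iff₀ (by positivity), hl, Nat.le_floor_iff (by have := hu.1; positivity), mul_comm u]
  have hval : ∀ i : ℕ, i ≤ M → haar (u + -((i : ℝ) / (2 * M))) = if i ≤ l then 1 else -1 := by
    intro i hi
    have hi' : (i : ℝ) ≤ M := by exact_mod_cast hi
    rw [hsign _ (by positivity) (by rw [div_le_iff₀ (by positivity)]; linarith)]
    simp only [hle]
  have hstep : cosStep M u = Real.cos (2 * Real.pi * (l / (2 * M))) := by
    rw [cosStep, Finset.sum_eq_single_of_mem l (Finset.mem_range.2 hlM)]
    · have h1 := hval l hlM.le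
      have h2 := hval (l + 1) hlM
      push_cast at h2
      rw [h1, h2, if_pos le_rfl, if_neg (by omega)]
      ring
    · intro i hi hil
      have hiM := Finset.mem_range.1 hi
      have h1 := hval i hiM.le
      have h2 := hval (i + 1) hiM
      push_cast at h2
      have : (i ≤ l) = (i + 1 ≤ l) := propext ⟨fun h => by omega, fun h => by omega⟩
      simp only [h1, h2, this, sub_self, mul_zero]
  rw [hstep]
  have hcos := Real.abs_cos_sub_cos_le (2 * Real.pi * u) (2 * Real.pi * (l / (2 * M)))
  refine hcos.trans ?_
  rw [← mul_sub, abs_mul, abs_of_pos (by positivity),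
    abs_of_nonneg (sub_nonneg.2 ((hle l).2 le_rfl))]
  have : u - l / (2 * M) ≤ 1 / (2 * M) := by
    rw [sub_le_iff_le_add, ← add_div, le_div_iff₀ (by positivity)]
    linarith
  calc 2 * Real.pi * (u - l / (2 * M)) ≤ 2 * Real.pi * (1 / (2 * M)) := by gcongr
    _ = Real.pi / M := by field_simp

end Cosine

/-! ### Uniform limits of sawtooth wave gradients. -/

section WaveApproximation

variable {m n : ℕ}

/-- The linear span of the gradients of sawtooth plane waves. -/
def waveSpan (m n : ℕ) : Submodule ℝ ((Fin n → ℝ) → Matrix (Fin m) (Fin n) ℝ) :=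
  Submodule.span ℝ {Y | ∃ (a : Fin m → ℝ) (k : Fin n → ℤ) (c : ℝ),
    Y = fun x => haar ((∑ j, x j * (k j : ℝ)) + c) • Matrix.vecMulVec a (fun j => (k j : ℝ))}

/-- Sums concatenate the lists of waves and scalars are absorbed into the amplitudes. The number of
waves grows, which is why all `N` are needed. -/
theorem exists_waveGradient_of_mem_waveSpan {Y : (Fin n → ℝ) → Matrix (Fin m) (Fin n) ℝ}
    (hY : Y ∈ waveSpan m n) :
    ∃ (N : ℕ) (a : Fin N → Fin m → ℝ) (k : Fin N → Fin n → ℤ) (c : Fin N → ℝ),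
      Y = waveGradient a k c := by
  induction hY using Submodule.span_induction with
  | mem Y h =>
    obtain ⟨a, k, c, rfl⟩ := h
    exact ⟨1, fun _ => a, fun _ => k, fun _ => c, by funext x; simp [waveGradient]⟩
  | zero => exact ⟨0, Fin.elim0, Fin.elim0, Fin.elim0, by funext x; simp [waveGradient]⟩
  | add Y Z _ _ hY hZ =>
    obtain ⟨N, a, k, c, rfl⟩ := hY
    obtain ⟨N', a', k', c', rfl⟩ := hZ
    refine ⟨N + N', Fin.append a a', Fin.append k k', Fin.append c c', ?_⟩
    funext x
    simp only [Pi.add_apply, waveGradient, Fin.sum_univ_add, Fin.append_left, Fin.append_right]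
  | smul r Y _ hY =>
    obtain ⟨N, a, k, c, rfl⟩ := hY
    refine ⟨N, fun i => r • a i, k, c, ?_⟩
    funext x
    simp only [Pi.smul_apply, waveGradient, Finset.smul_sum, Matrix.smul_vecMulVec,
      smul_comm r]

theorem mem_waveSpan_of_mem_haarSpan {g : ℝ → ℝ} (hg : g ∈ haarSpan) (a : Fin m → ℝ)
    (k : Fin n → ℤ) (c : ℝ) :
    (fun x => g ((∑ j, x j * (k j : ℝ)) + c) • Matrix.vecMulVec a (fun j => (k j : ℝ))) ∈
      waveSpan m n := by
  induction hg using Submodule.span_induction with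
  | mem g h =>
    obtain ⟨c', rfl⟩ := h
    exact Submodule.subset_span ⟨a, k, c + c', by simp only [add_assoc]⟩
  | zero =>
    simp only [Pi.zero_apply, zero_smul]
    exact (waveSpan m n).zero_mem
  | add g h _ _ hg hh =>
    simp only [Pi.add_apply, add_smul]
    exact (waveSpan m n).add_mem hg hh
  | smul r g _ hg =>
    simp only [Pi.smul_apply, smul_assoc]
    exact (waveSpan m n).smul_mem r hg

/-- Matrix fields that are uniform limits of gradients of sums of sawtooth plane waves. -/
def IsWaveLimit (Y : (Fin n → ℝ) → Matrix (Fin m) (Fin n) ℝ) : Prop :=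
  ∀ η > 0, ∃ Z ∈ waveSpan m n, ∀ x i j, |Y x i j - Z x i j| ≤ η

theorem IsWaveLimit.add {Y Z : (Fin n → ℝ) → Matrix (Fin m) (Fin n) ℝ} (hY : IsWaveLimit Y)
    (hZ : IsWaveLimit Z) : IsWaveLimit fun x => Y x + Z x := by
  intro η hη
  obtain ⟨Y', hY', h1⟩ := hY (η / 2) (by positivity)
  obtain ⟨Z', hZ', h2⟩ := hZ (η / 2) (by positivity)
  refine ⟨Y' + Z', Submodule.add_mem _ hY' hZ', fun x i j => ?_⟩
  calc |(Y x + Z x) i j - (Y' + Z') x i j|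
      = |(Y x i j - Y' x i j) + (Z x i j - Z' x i j)| := by
        simp only [Pi.add_apply, Matrix.add_apply]; congr 1; ring
    _ ≤ η := by linarith [abs_add_le (Y x i j - Y' x i j) (Z x i j - Z' x i j), h1 x i j, h2 x i j]

theorem IsWaveLimit.sum {ι : Type*} (s : Finset ι)
    {Y : ι → (Fin n → ℝ) → Matrix (Fin m) (Fin n) ℝ} (hY : ∀ l ∈ s, IsWaveLimit (Y l)) :
    IsWaveLimit fun x => ∑ l ∈ s, Y l x := by
  classical
  induction s using Finset.induction_on with
  | empty => exact fun η hη => ⟨0, Submodule.zero_mem _, by simp [hη.le]⟩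
  | insert a s ha ih =>
    simp_rw [Finset.sum_insert ha]
    exact (hY a (Finset.mem_insert_self a s)).add
      (ih fun l hl => hY l (Finset.mem_insert_of_mem hl))

theorem IsWaveLimit.of_forall_exists {Y : (Fin n → ℝ) → Matrix (Fin m) (Fin n) ℝ}
    (h : ∀ η > 0, ∃ Z, IsWaveLimit Z ∧ ∀ x i j, |Y x i j - Z x i j| ≤ η) : IsWaveLimit Y := by
  intro η hη
  obtain ⟨Z, hZ, h1⟩ := h (η / 2) (by positivity)
  obtain ⟨Z', hZ', h2⟩ := hZ (η / 2) (by positivity)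
  refine ⟨Z', hZ', fun x i j => ?_⟩
  linarith [abs_sub_le (Y x i j) (Z x i j) (Z' x i j), h1 x i j, h2 x i j]

theorem isWaveLimit_cos (a : Fin m → ℝ) (k : Fin n → ℤ) (c : ℝ) :
    IsWaveLimit fun x => Real.cos (2 * Real.pi * ((∑ j, x j * (k j : ℝ)) + c)) •
      Matrix.vecMulVec a (fun j => (k j : ℝ)) := by
  intro η hη
  set C : ℝ := ∑ i, ∑ j, |a i * (k j : ℝ)| with hC
  have hC0 : 0 ≤ C := Finset.sum_nonneg fun i _ => Finset.sum_nonneg fun j _ => abs_nonneg _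
  -- The sampling error `π / M` is multiplied by entries of size at most `C`.
  obtain ⟨M, hM⟩ := exists_nat_gt (Real.pi * C / η)
  have hM' : (0 : ℝ) < M := lt_of_le_of_lt (by positivity) hM
  refine ⟨_, mem_waveSpan_of_mem_haarSpan (cosStep_mem_haarSpan M) a k c, fun x i j => ?_⟩
  have hij : |a i * (k j : ℝ)| ≤ C :=
    (Finset.single_le_sum (f := fun j => |a i * (k j : ℝ)|) (fun j _ => abs_nonneg _)
      (Finset.mem_univ j)).trans
    (Finset.single_le_sum (f := fun i => ∑ j, |a i * (k j : ℝ)|)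
      (fun i _ => Finset.sum_nonneg fun j _ => abs_nonneg _) (Finset.mem_univ i))
  change |(Real.cos _ • Matrix.vecMulVec a (fun j => (k j : ℝ))) i j - _| ≤ η
  rw [Matrix.smul_apply, Matrix.smul_apply, ← sub_smul, smul_eq_mul, abs_mul,
    Matrix.vecMulVec_apply]
  calc _ ≤ Real.pi / M * C := mul_le_mul (abs_cos_sub_cosStep_le (by exact_mod_cast hM') _) hij
        (abs_nonneg _) (by positivity)
    _ ≤ η := by
      rw [div_mul_eq_mul_div, div_le_iff₀ hM']
      rw [div_lt_iff₀ hη] at hM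
      linarith

end WaveApproximation

/-! ### Trigonometric approximation on the torus. -/

section Torus

open MeasureTheory Filter Topology UnitAddTorus

instance isProbabilityMeasure_volume_unitAddCircle :
    IsProbabilityMeasure (volume : Measure UnitAddCircle) :=
  ⟨by simp⟩

instance isProbabilityMeasure_volume_unitAddTorus (n : ℕ) :
    IsProbabilityMeasure (volume : Measure (UnitAddTorus (Fin n))) := by
  rw [volume_pi]; infer_instance

variable {n : ℕ}

theorem mFourier_sub (k : Fin n → ℤ) (x y : UnitAddTorus (Fin n)) :
    mFourier k (y - x) = mFourier (-k) x * mFourier k y := by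
  simp only [mFourier, ContinuousMap.coe_mk, Pi.sub_apply, Pi.neg_apply, fourier_apply,
    ← Finset.prod_mul_distrib]
  refine Finset.prod_congr rfl fun i _ => ?_
  rw [← Circle.coe_mul, ← AddCircle.toCircle_add, smul_sub, neg_smul, neg_add_eq_sub]

theorem exists_bump_unitAddTorus {δ : ℝ} (hδ : 0 < δ) :
    ∃ g : C(UnitAddTorus (Fin n), ℝ), (∀ y, 0 ≤ g y) ∧ (∀ y, δ ≤ ‖y‖ → g y = 0) ∧
      ∫ y, g y = 1 := by
  let g₀ : C(UnitAddTorus (Fin n), ℝ) := ⟨fun y => max 0 (δ - ‖y‖), by fun_prop⟩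
  have hpos : 0 < ∫ y, g₀ y := by
    refine Continuous.integral_pos_of_hasCompactSupport_nonneg_nonzero (x := 0) g₀.continuous
      (HasCompactSupport.of_compactSpace _) (fun y => le_max_left _ _) ?_
    simp only [g₀, ContinuousMap.coe_mk, norm_zero, sub_zero]
    exact (lt_max_of_lt_right hδ).ne'
  refine ⟨(∫ y, g₀ y)⁻¹ • g₀, fun y => ?_, fun y hy => ?_, ?_⟩
  · exact mul_nonneg (inv_nonneg.2 hpos.le) (le_max_left _ _)
  · simp [g₀, hy]
  · simp only [ContinuousMap.smul_apply, smul_eq_mul]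
    rw [integral_const_mul, inv_mul_cancel₀ hpos.ne']

variable {E : Type*} [NormedAddCommGroup E] [NormedSpace ℂ E] [CompleteSpace E]

/-- Averaging `u` against a concentrated bump changes it little by uniform continuity, and the bump
is a uniform limit of trigonometric polynomials. The kernel `P` need not be positive or normalised.
-/
theorem exists_trigonometric_kernel (u : C(UnitAddTorus (Fin n), E)) {η : ℝ} (hη : 0 < η) :
    ∃ P ∈ Submodule.span ℂ (Set.range (mFourier (d := Fin n))),
      ∀ x, ‖u x - ∫ y, P y • u (x + y)‖ ≤ η := by
  obtain ⟨δ, hδ, hu⟩ := Metric.uniformContinuous_iff.1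
    (CompactSpace.uniformContinuous_of_continuous u.continuous) (η / 2) (by positivity)
  obtain ⟨g, hg0, hgδ, hg1⟩ := exists_bump_unitAddTorus (n := n) hδ
  let G : C(UnitAddTorus (Fin n), ℂ) := ⟨fun y => (g y : ℂ), by fun_prop⟩
  have hG : G ∈ closure (Submodule.span ℂ (Set.range (mFourier (d := Fin n))) :
      Set C(UnitAddTorus (Fin n), ℂ)) := by
    rw [← Submodule.topologicalClosure_coe, span_mFourier_closure_eq_top]
    trivial
  obtain ⟨P, hP, hPG⟩ := Metric.mem_closure_iff.1 hG (η / (2 * (‖u‖ + 1))) (by positivity)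
  refine ⟨P, hP, fun x => ?_⟩
  have hint : ∀ F : UnitAddTorus (Fin n) → E, Continuous F → Integrable F := fun F hF =>
    hF.integrable_of_hasCompactSupport (HasCompactSupport.of_compactSpace F)
  have hx : u x = ∫ y, g y • u x := by
    rw [integral_smul_const, hg1, one_smul]
  have h1 : u x - ∫ y, P y • u (x + y) =
      (∫ y, g y • (u x - u (x + y))) + ∫ y, (G y - P y) • u (x + y) := by
    rw [← integral_add (hint _ (by fun_prop)) (hint _ (by fun_prop))]
    nth_rewrite 1 [hx]
    rw [← integral_sub (hint _ (by fun_prop)) (hint _ (by fun_prop))]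
    refine integral_congr_ae (ae_of_all _ fun y => ?_)
    simp only [G, ContinuousMap.coe_mk, smul_sub, sub_smul, Complex.coe_smul]
    abel
  have h2 : ‖∫ y, g y • (u x - u (x + y))‖ ≤ η / 2 := by
    calc ‖∫ y, g y • (u x - u (x + y))‖ ≤ ∫ y, g y * (η / 2) := by
          refine norm_integral_le_of_norm_le
            ((g.continuous.mul continuous_const).integrable_of_hasCompactSupport
              (HasCompactSupport.of_compactSpace _)) (ae_of_all _ fun y => ?_)
          rw [norm_smul, Real.norm_of_nonneg (hg0 y)]
          by_cases hy : ‖y‖ < δ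
          · refine mul_le_mul_of_nonneg_left ?_ (hg0 y)
            rw [← dist_eq_norm]
            exact (hu (by simpa [dist_eq_norm] using hy)).le
          · simp [hgδ y (not_lt.1 hy)]
      _ = η / 2 := by rw [integral_mul_const, hg1, one_mul]
  have h3 : ‖∫ y, (G y - P y) • u (x + y)‖ ≤ η / 2 := by
    refine (norm_integral_le_of_norm_le_const (C := η / 2) (ae_of_all _ fun y => ?_)).trans
      (by simp)
    rw [norm_smul]
    calc ‖G y - P y‖ * ‖u (x + y)‖ ≤ (η / (2 * (‖u‖ + 1))) * (‖u‖ + 1) := by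
          refine mul_le_mul ?_ ((u.norm_coe_le_norm _).trans (by linarith)) (norm_nonneg _)
            (by positivity)
          rw [dist_eq_norm] at hPG
          exact ((G - P).norm_coe_le_norm y).trans hPG.le
      _ = η / 2 := by field_simp
  rw [h1]
  exact (norm_add_le _ _).trans (by linarith)

/-- The approximation comes from a convolution, so its coefficients are scalar multiples of the
Fourier coefficients of `u`. Any linear constraint on those, such as being of the form `b ⊗ k`, is
inherited. -/
theorem exists_trigonometric_approximation (u : C(UnitAddTorus (Fin n), E)) {η : ℝ} (hη : 0 < η) :
    ∃ (s : Finset (Fin n → ℤ)) (c : (Fin n → ℤ) → ℂ),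
      ∀ x, ‖u x - ∑ k ∈ s, (c k * mFourier (-k) x) • ∫ y, mFourier k y • u y‖ ≤ η := by
  obtain ⟨P, hP, h⟩ := exists_trigonometric_kernel u hη
  obtain ⟨c, rfl⟩ := Finsupp.mem_span_range_iff_exists_finsupp.1 hP
  refine ⟨c.support, c, fun x => ?_⟩
  convert h x using 3
  have hshift : ∫ y, (c.sum fun k a => a • mFourier k) y • u (x + y) =
      ∫ y, (c.sum fun k a => a • mFourier k) (y - x) • u y := by
    rw [← integral_add_left_eq_self
      (fun y => (c.sum fun k a => a • mFourier k) (y - x) • u y) x]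
    simp only [add_sub_cancel_left]
  have hexp : ∀ y, (c.sum fun k a => a • mFourier k) (y - x) • u y =
      ∑ k ∈ c.support, (c k * mFourier (-k) x) • mFourier k y • u y := by
    intro y
    rw [Finsupp.sum, ContinuousMap.sum_apply, Finset.sum_smul]
    refine Finset.sum_congr rfl fun k _ => ?_
    rw [ContinuousMap.smul_apply, mFourier_sub, smul_eq_mul, smul_smul, mul_assoc]
  rw [hshift]
  simp_rw [hexp]
  rw [integral_finsetSum _ fun k _ => Continuous.integrable_of_hasCompactSupport (by fun_prop)
    (HasCompactSupport.of_compactSpace _)]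
  exact Finset.sum_congr rfl fun k _ => (integral_smul _ _).symm

/-- The quotient map from `ℝⁿ` to the torus. -/
def toTorus (x : Fin n → ℝ) : UnitAddTorus (Fin n) := fun i => (x i : UnitAddCircle)

theorem isOpenQuotientMap_toTorus : IsOpenQuotientMap (toTorus (n := n)) :=
  IsOpenQuotientMap.piMap fun _ => QuotientAddGroup.isOpenQuotientMap_mk

theorem exists_lift_unitAddTorus {X : Type*} [TopologicalSpace X] {v : (Fin n → ℝ) → X}
    (hv : Continuous v)
    (hper : ∀ (x : Fin n → ℝ) (k : Fin n → ℤ), v (x + fun j => (k j : ℝ)) = v x) :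
    ∃ u : C(UnitAddTorus (Fin n), X), ∀ x, u (toTorus x) = v x := by
  have hfac : Function.FactorsThrough v (toTorus (n := n)) := by
    intro x y hxy
    have : ∀ i, ∃ k : ℤ, x i = y i + k := fun i => by
      have h := (QuotientAddGroup.eq_iff_sub_mem).1 (congrFun hxy i)
      obtain ⟨k, hk⟩ := AddSubgroup.mem_zmultiples_iff.1 h
      exact ⟨k, by rw [zsmul_eq_mul, mul_one] at hk; linarith⟩
    choose k hk using this
    rw [← hper y k]
    exact congrArg v (funext hk)
  let q : C(Fin n → ℝ, UnitAddTorus (Fin n)) := ⟨toTorus, isOpenQuotientMap_toTorus.continuous⟩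
  have hq : Topology.IsQuotientMap q := isOpenQuotientMap_toTorus.isQuotientMap
  refine ⟨hq.lift ⟨v, hv⟩ hfac, fun x => ?_⟩
  exact DFunLike.congr_fun (hq.lift_comp ⟨v, hv⟩ hfac) x

theorem mFourier_toTorus (k : Fin n → ℤ) (x : Fin n → ℝ) :
    mFourier k (toTorus x) =
      Complex.exp (((2 * Real.pi * ∑ j, x j * (k j : ℝ) : ℝ) : ℂ) * Complex.I) := by
  simp only [mFourier, ContinuousMap.coe_mk, toTorus]
  rw [Finset.prod_congr rfl fun j _ => fourier_coe_apply, ← Complex.exp_sum]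
  congr 1
  push_cast
  rw [Finset.mul_sum, Finset.sum_mul]
  exact Finset.sum_congr rfl fun j _ => by ring

theorem measurePreserving_toTorus :
    MeasurePreserving (toTorus (n := n)) (volume.restrict (Set.Icc 0 1)) volume := by
  have h := measurePreserving_pi
    (fun _ : Fin n => (volume : Measure ℝ).restrict (Set.Ioc 0 (0 + 1)))
    (fun _ => (volume : Measure UnitAddCircle)) fun _ => UnitAddCircle.measurePreserving_mk 0
  rw [← Measure.restrict_pi_pi, ← volume_pi, ← volume_pi, zero_add] at h
  have e : (Set.univ.pi fun _ : Fin n => Set.Ioc (0 : ℝ) 1) =ᵐ[volume] Set.Icc 0 1 :=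
    Measure.univ_pi_Ioc_ae_eq_Icc
  rw [Measure.restrict_congr_set e] at h
  exact h

end Torus

/-! ### Integrals of derivatives of periodic maps vanish. -/

section IntegrationByParts

open MeasureTheory

/-- This is the divergence theorem for the field whose only component is `v` in direction `j`;
periodicity makes the two opposite faces cancel. -/
theorem integral_fderiv_single_eq_zero {n : ℕ} {E : Type*} [NormedAddCommGroup E] [NormedSpace ℝ E]
    {v : (Fin n → ℝ) → E} (hv : ContDiff ℝ 1 v)
    (hper : ∀ (x : Fin n → ℝ) (k : Fin n → ℤ), v (x + fun j => (k j : ℝ)) = v x) (j : Fin n) :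
    ∫ x in Set.Icc (0 : Fin n → ℝ) 1, fderiv ℝ v x (Pi.single j 1) = 0 := by
  cases n with
  | zero => exact j.elim0
  | succ n =>
    have hc : Continuous fun x => fderiv ℝ v x (Pi.single j 1) :=
      (hv.continuous_fderiv one_ne_zero).clm_apply continuous_const
    have hsum : ∀ x, ∑ i, (if i = j then fderiv ℝ v x else 0) (Pi.single i 1) =
        fderiv ℝ v x (Pi.single j 1) := by
      intro x
      rw [Finset.sum_eq_single_of_mem j (Finset.mem_univ j) (fun i _ hij => by simp [hij])]
      simp
    have h := integral_divergence_of_hasFDerivAt_off_countable' (0 : Fin (n + 1) → ℝ) 1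
      zero_le_one (fun i x => if i = j then v x else 0)
      (fun i x => if i = j then fderiv ℝ v x else 0) ∅ Set.countable_empty
      (fun i => by
        by_cases hij : i = j
        · simpa [hij] using hv.continuous.continuousOn
        · simpa [hij] using continuousOn_const)
      (fun x _ i => by
        by_cases hij : i = j
        · simpa [hij] using (hv.differentiable one_ne_zero x).hasFDerivAt
        · simpa [hij] using hasFDerivAt_const (0 : E) x)
      (by simp_rw [hsum]; exact hc.continuousOn.integrableOn_compact isCompact_Icc)
    simp_rw [hsum] at h
    rw [h]
    refine Finset.sum_eq_zero fun i _ => ?_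
    by_cases hij : i = j
    · subst hij
      simp only [if_true]
      rw [sub_eq_zero]
      congr 1
      funext y
      refine Eq.trans (congrArg v (funext fun l => ?_))
        (hper (i.insertNth ((0 : Fin (n + 1) → ℝ) i) y) (Pi.single i 1))
      rcases Fin.eq_self_or_eq_succAbove i l with rfl | ⟨l, rfl⟩ <;> simp
    · simp [hij]

end IntegrationByParts

/-! ### Periodic gradients as wave limits, and the converse implication. -/

section SmoothGradients

open MeasureTheory Filter Topology UnitAddTorus

variable {m n : ℕ}

theorem norm_apply_apply_le_norm {F : Type*} [SeminormedAddCommGroup F] (B : Fin m → Fin n → F)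
    (i : Fin m) (j : Fin n) : ‖B i j‖ ≤ ‖B‖ :=
  (norm_le_pi_norm (B i) j).trans (norm_le_pi_norm B i)

theorem continuous_jacobian {φ : (Fin n → ℝ) → (Fin m → ℝ)} (hφ : ContDiff ℝ ∞ φ) :
    Continuous (jacobian φ) := by
  refine continuous_matrix fun i j => ?_
  exact (continuous_apply i).comp
    ((hφ.continuous_fderiv (by simp)).clm_apply continuous_const)

theorem jacobian_add_intCast {φ : (Fin n → ℝ) → (Fin m → ℝ)} (hper : IsPeriodic φ)
    (x : Fin n → ℝ) (k : Fin n → ℤ) : jacobian φ (x + fun j => (k j : ℝ)) = jacobian φ x := by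
  have h : (fun x => φ (x + fun j => (k j : ℝ))) = φ := funext fun x => hper x k
  ext i j
  simp only [jacobian, Matrix.of_apply]
  rw [← fderiv_comp_add_right, h]

/-- Integration by parts against the exponential monomials on the torus. -/
theorem integral_mFourier_mul_jacobian {φ : (Fin n → ℝ) → (Fin m → ℝ)} (hφ : ContDiff ℝ ∞ φ)
    (hper : IsPeriodic φ) (k : Fin n → ℤ) (i : Fin m) (j : Fin n) :
    ∫ x in Set.Icc (0 : Fin n → ℝ) 1, mFourier k (toTorus x) * (jacobian φ x i j : ℂ) =
      -(2 * Real.pi * Complex.I * k j) *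
        ∫ x in Set.Icc (0 : Fin n → ℝ) 1, mFourier k (toTorus x) * (φ x i : ℂ) := by
  let e : (Fin n → ℝ) → ℂ := fun x =>
    Complex.exp (((2 * Real.pi * ∑ j, x j * (k j : ℝ) : ℝ) : ℂ) * Complex.I)
  have he : ∀ x, mFourier k (toTorus x) = e x := mFourier_toTorus k
  have hec : ContDiff ℝ ∞ e := by
    have h1 : ContDiff ℝ ∞ fun x : Fin n → ℝ => 2 * Real.pi * ∑ j, x j * (k j : ℝ) := by fun_prop
    exact ((Complex.ofRealCLM.contDiff.comp h1).mul contDiff_const).cexp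
  have hφi : ContDiff ℝ ∞ fun x => (φ x i : ℂ) :=
    Complex.ofRealCLM.contDiff.comp (contDiff_pi.1 hφ i)
  have hde : ∀ x, fderiv ℝ e x (Pi.single j 1) = (2 * Real.pi * Complex.I * k j) * e x := by
    intro x
    have h1 : HasFDerivAt (fun x : Fin n → ℝ => ∑ j, x j * (k j : ℝ))
        (∑ j, (k j : ℝ) • ContinuousLinearMap.proj (R := ℝ) (φ := fun _ : Fin n => ℝ) j) x :=
      HasFDerivAt.fun_sum fun j _ => (hasFDerivAt_apply j x).mul_const (k j : ℝ)
    have h2 := ((Complex.ofRealCLM.hasFDerivAt.comp x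
      (h1.const_mul (2 * Real.pi))).mul_const Complex.I).cexp
    have h3 : HasFDerivAt e _ x := h2
    rw [h3.fderiv]
    simp [e, Pi.single_apply]
    ring
  have hdφ : ∀ x, fderiv ℝ (fun x => (φ x i : ℂ)) x (Pi.single j 1) = (jacobian φ x i j : ℂ) := by
    intro x
    have h1 := Complex.ofRealCLM.hasFDerivAt.comp x
      (hasFDerivAt_pi'.1 (hφ.differentiable (by simp) x).hasFDerivAt i)
    have h2 : HasFDerivAt (fun x => (φ x i : ℂ)) _ x := h1
    rw [h2.fderiv]
    simp [jacobian]
  have hv : ∀ x, fderiv ℝ (fun x => e x * (φ x i : ℂ)) x (Pi.single j 1) =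
      e x * (jacobian φ x i j : ℂ) + (2 * Real.pi * Complex.I * k j) * (e x * (φ x i : ℂ)) := by
    intro x
    rw [fderiv_fun_mul (hec.differentiable (by simp) x) (hφi.differentiable (by simp) x)]
    simp only [add_apply, smul_apply, hde, hdφ, smul_eq_mul]
    ring
  have hzero := integral_fderiv_single_eq_zero ((hec.mul hφi).of_le (by simp)) (fun x l => by
    have h1 : toTorus (x + fun j => (l j : ℝ)) = toTorus x := by
      funext i
      simp [toTorus]
    simp only [← he, h1, hper x l]) j
  have hJ : Continuous fun x => (jacobian φ x i j : ℂ) :=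
    Complex.continuous_ofReal.comp ((continuous_jacobian hφ).matrix_elem i j)
  simp_rw [hv] at hzero
  have h1 : IntegrableOn (fun x => e x * (jacobian φ x i j : ℂ)) (Set.Icc 0 1) :=
    (hec.continuous.mul hJ).continuousOn.integrableOn_compact isCompact_Icc
  have h2 : IntegrableOn (fun x => (2 * Real.pi * Complex.I * k j) * (e x * (φ x i : ℂ)))
      (Set.Icc 0 1) :=
    (continuous_const.mul (hec.continuous.mul hφi.continuous)).continuousOn.integrableOn_compact
      isCompact_Icc
  rw [integral_add h1 h2, integral_const_mul] at hzero
  simp_rw [he]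
  rw [neg_mul]
  exact eq_neg_of_add_eq_zero_left hzero

/-- The sine is written as a cosine shifted by a quarter period, and a zero shift is kept in the
first term, so that both terms have the shape of `isWaveLimit_cos`. -/
theorem re_mul_mFourier_neg (w : ℂ) (k : Fin n → ℤ) (x : Fin n → ℝ) :
    (w * mFourier (-k) (toTorus x)).re =
      Real.cos (2 * Real.pi * ((∑ j, x j * (k j : ℝ)) + 0)) * w.re +
        Real.cos (2 * Real.pi * ((∑ j, x j * (k j : ℝ)) + -(1 / 4))) * w.im := by
  rw [mFourier_neg, mFourier_toTorus, ← Complex.exp_conj, map_mul, Complex.conj_I,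
    Complex.conj_ofReal, mul_neg, ← neg_mul, ← Complex.ofReal_neg, Complex.mul_re,
    Complex.exp_ofReal_mul_I_re, Complex.exp_ofReal_mul_I_im, Real.cos_neg, Real.sin_neg, add_zero]
  have : Real.cos (2 * Real.pi * ((∑ j, x j * (k j : ℝ)) + -(1 / 4))) =
      Real.sin (2 * Real.pi * ∑ j, x j * (k j : ℝ)) := by
    rw [← Real.cos_sub_pi_div_two]
    congr 1
    ring
  rw [this]
  ring

theorem isWaveLimit_jacobian {φ : (Fin n → ℝ) → (Fin m → ℝ)} (hφ : ContDiff ℝ ∞ φ)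
    (hper : IsPeriodic φ) : IsWaveLimit (jacobian φ) := by
  refine IsWaveLimit.of_forall_exists fun η hη => ?_
  obtain ⟨u, hu⟩ := exists_lift_unitAddTorus
    (v := fun x => (fun i j => (jacobian φ x i j : ℂ) : Fin m → Fin n → ℂ))
    (continuous_pi fun i => continuous_pi fun j =>
      Complex.continuous_ofReal.comp ((continuous_jacobian hφ).matrix_elem i j))
    (fun x k => by simp only [jacobian_add_intCast hper])
  obtain ⟨s, c, h⟩ := exists_trigonometric_approximation u hη
  -- Integration by parts leaves the factor `k j` as the only dependence on `j`; the rest is the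
  -- amplitude `b k`, whose real and imaginary parts give two real waves.
  let b : (Fin n → ℤ) → Fin m → ℂ := fun k i => c k * (-(2 * Real.pi * Complex.I) *
    ∫ x in Set.Icc (0 : Fin n → ℝ) 1, mFourier k (toTorus x) * (φ x i : ℂ))
  have hcoeff : ∀ k i j, (∫ y, mFourier k y • u y) i j =
      -(2 * Real.pi * Complex.I * k j) *
        ∫ x in Set.Icc (0 : Fin n → ℝ) 1, mFourier k (toTorus x) * (φ x i : ℂ) := by
    intro k i j
    rw [← integral_mFourier_mul_jacobian hφ hper]
    have hint : Integrable fun y => mFourier k y • u y :=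
      Continuous.integrable_of_hasCompactSupport (by fun_prop) (HasCompactSupport.of_compactSpace _)
    have h1 := ((ContinuousLinearMap.proj (R := ℂ) (φ := fun _ : Fin n => ℂ) j).comp
      (ContinuousLinearMap.proj (R := ℂ) (φ := fun _ : Fin m => Fin n → ℂ) i)).integral_comp_comm
      hint
    simp only [ContinuousLinearMap.comp_apply, ContinuousLinearMap.proj_apply, Pi.smul_apply,
      smul_eq_mul] at h1
    rw [← h1, ← (measurePreserving_toTorus (n := n)).map_eq,
      integral_map measurePreserving_toTorus.aemeasurable
        (Continuous.aestronglyMeasurable (by fun_prop))]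
    simp only [hu]
  refine ⟨fun x => ∑ k ∈ s,
    (Real.cos (2 * Real.pi * ((∑ j, x j * (k j : ℝ)) + 0)) •
        Matrix.vecMulVec (fun i => (b k i).re) (fun j => (k j : ℝ)) +
      Real.cos (2 * Real.pi * ((∑ j, x j * (k j : ℝ)) + -(1 / 4))) •
        Matrix.vecMulVec (fun i => (b k i).im) (fun j => (k j : ℝ))),
    IsWaveLimit.sum s fun k _ => (isWaveLimit_cos _ k 0).add (isWaveLimit_cos _ k _),
    fun x i j => ?_⟩
  refine le_trans ?_ ((norm_apply_apply_le_norm _ i j).trans (h (toTorus x)))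
  rw [hu]
  refine le_trans (le_of_eq ?_) (Complex.abs_re_le_norm _)
  congr 1
  simp only [Pi.sub_apply, Finset.sum_apply, Pi.smul_apply, smul_eq_mul, hcoeff, Complex.sub_re,
    Complex.ofReal_re, Complex.re_sum, Matrix.sum_apply, Matrix.add_apply, Matrix.smul_apply,
    Matrix.vecMulVec_apply]
  congr 1
  refine Finset.sum_congr rfl fun k _ => ?_
  have e : c k * mFourier (-k) (toTorus x) * (-(2 * Real.pi * Complex.I * k j) *
      ∫ x in Set.Icc (0 : Fin n → ℝ) 1, mFourier k (toTorus x) * (φ x i : ℂ)) =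
      ((k j : ℝ) : ℂ) * (b k i * mFourier (-k) (toTorus x)) := by
    simp only [b]
    push_cast
    ring
  rw [e, Complex.re_ofReal_mul, re_mul_mFourier_neg]
  ring

theorem quasiconvex_of_waveQuasiconvex {f : Matrix (Fin m) (Fin n) ℝ → ℝ}
    (h : ∀ N, WaveQuasiconvex N f) (hf : Measurable[borel (Matrix (Fin m) (Fin n) ℝ)] f) :
    Quasiconvex f := by
  have hc := (h 1).midpointConvexAlongAxes.continuous hf
  intro A φ hφ hper
  have hcA : Continuous fun B => f (A + B) := hc.comp (continuous_const.add continuous_id)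
  have hJ := continuous_jacobian hφ
  refine ⟨((hcA.comp hJ).continuousOn.integrableOn_compact
    (isCompact_Icc (a := (0 : Fin n → ℝ)) (b := 1))).mono_set ?_, ?_⟩
  · intro x hx
    exact ⟨fun i => (hx i trivial).1, fun i => (hx i trivial).2.le⟩
  have happrox : ∀ l : ℕ, ∃ (N : ℕ) (a : Fin N → Fin m → ℝ) (k : Fin N → Fin n → ℤ)
      (c : Fin N → ℝ),
      ∀ x i j, |jacobian φ x i j - waveGradient a k c x i j| ≤ 1 / ((l : ℝ) + 1) := by
    intro l
    obtain ⟨Z, hZ, hZ'⟩ := isWaveLimit_jacobian hφ hper (1 / ((l : ℝ) + 1)) (by positivity)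
    obtain ⟨N, a, k, c, rfl⟩ := exists_waveGradient_of_mem_waveSpan hZ
    exact ⟨N, a, k, c, hZ'⟩
  choose N a k c hY using happrox
  -- The bound must hold on all of `ℝⁿ`; it comes from compactness of the torus.
  obtain ⟨C, hC⟩ : ∃ C, ∀ x i j, |jacobian φ x i j| ≤ C := by
    obtain ⟨u, hu⟩ := exists_lift_unitAddTorus
      (v := fun x => (fun i j => jacobian φ x i j : Fin m → Fin n → ℝ))
      (continuous_pi fun i => continuous_pi fun j => hJ.matrix_elem i j)
      (fun x k => by simp only [jacobian_add_intCast hper])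
    refine ⟨‖u‖, fun x i j => ?_⟩
    refine le_trans ?_ ((norm_apply_apply_le_norm _ i j).trans (u.norm_coe_le_norm (toTorus x)))
    rw [hu, Real.norm_eq_abs]
  have hlim := tendsto_integral_unitCube_comp hcA (C := C + 1)
    (Y := fun l => waveGradient (a l) (k l) (c l)) (Z := jacobian φ)
    (fun l x i j => by
      have h1 := hY l x i j
      have h2 : 1 / ((l : ℝ) + 1) ≤ 1 := by
        rw [div_le_one (by positivity)]
        linarith [(l.cast_nonneg : (0 : ℝ) ≤ l)]
      have h3 := abs_sub_abs_le_abs_sub (waveGradient (a l) (k l) (c l) x i j) (jacobian φ x i j)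
      rw [abs_sub_comm] at h3
      linarith [hC x i j])
    (fun l => (measurable_comp_waveGradient (fun B => f (A + B)) _ _ _).aestronglyMeasurable)
    (fun x i j => by
      rw [tendsto_iff_dist_tendsto_zero]
      refine squeeze_zero (fun _ => dist_nonneg) (fun l => ?_)
        (tendsto_one_div_add_atTop_nhds_zero_nat (𝕜 := ℝ))
      rw [dist_comm, Real.dist_eq]
      exact hY l x i j)
  exact ge_of_tendsto' hlim fun l => (waveQuasiconvex_iff f).1 (h (N l)) A (a l) (k l) (c l)

end SmoothGradients
end PlaneWave

theorem proposition3p2 {m n : ℕ} (f : Matrix (Fin m) (Fin n) ℝ → ℝ)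
    (hf : Measurable[borel (Matrix (Fin m) (Fin n) ℝ)] f) :
    PlaneWave.Quasiconvex f ↔ ∀ N : ℕ, PlaneWave.WaveQuasiconvex N f :=
  ⟨fun h N => h.waveQuasiconvex hf N, fun h => PlaneWave.quasiconvex_of_waveQuasiconvex h hf⟩
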